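/- Let $\tilde\Phi=\{(X_i,M_i)\}_{i\in\mathbb N}$ be an independently marked homogeneous Poisson point process in $\mathbb R^2$ of intensity $\lambda\in(0,\infty)$: the points $X_i$ form a homogeneous Poisson process of intensity $\lambda$, and the marks $M_i=(A_i,Y_i,S_i^0)$ are i.i.d. and independent of the points. The components of a mark may depend on each other. The shape $A_i$ is a random closed convex subset of $\mathbb R^2$. Object $i$ is a sensor with probability $p_s>0$. If it is one, then $Y_i\in A_i$ is the position of the sensor relative to $X_i$, and $S_i^0=\{(r\cos\theta,r\sin\theta): 0\le r\le r^i_{\max}(\theta),\ \theta\in[0,2\pi]\}$ with a random finite-valued measurable function $r^i_{\max}\ge 0$; otherwise $Y_i=0$ and $S_i^0=\emptyset$. Let $E_i=\{X_i\}\oplus A_i$, $E^{-i}=\bigcup_{j\ne i}E_j$, where $\oplus$ is the Minkowski sum, let $l_{y,x}$ be the closed segment from $y$ to $x$, and let $|\cdot|$ be the area. The coverage set of sensor $i$ is $$C_i=\{x\in\{X_i+Y_i\}\oplus S_i^0 : x\in E_i\ \text{ or }\ l_{X_i+Y_i,x}\cap E^{-i}\subseteq\{x\}\}.$$ Let $C^0$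 be the coverage set of a typical sensor shifted to the origin, that is, under the Palm distribution: for every Borel set $B$ with $0<|B|<\infty$, $\mathbb E|C^0|$ is the mean of the sum of $|C_i-X_i|$ over the sensors $i$ with $X_i\in B$, divided by the mean number of such sensors. Let $(A^0,Y^0,S^0)$ have the law of a mark conditioned on being that of a sensor, let $A$ have the (unconditional) law of the shape of an object, and let $\check A=\{x:-x\in A\}$. Then, in $[0,\infty]$ and with $e^{-\infty}=0$, $$\mathbb E|C^0| = \mathbb E\big|(\{Y^0\}\oplus S^0)\cap A^0\big| + \mathbb E\int_{(\{Y^0\}\oplus S^0)\setminus A^0} e^{-\lambda\,\mathbb E|l_{Y^0,x}\oplus\check A|}\,dx,$$ where the inner expectation is over $A$ only. Moreover, the second term is the expected area, for the typical sensor, of the set of the locations $x\in(\{Y^0\}\oplus S^0)\setminus A^0$ for which no other object meets $l_{Y^0,x}$. -/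

import Mathlib

open MeasureTheory ProbabilityTheory
open scoped ENNReal NNReal Pointwise

noncomputable section

/-- The Euclidean plane, with its Lebesgue measure `volume`. -/
abbrev Plane : Type := EuclideanSpace ℝ (Fin 2)

/-- The points with polar coordinates `(r, θ)`, `r ∈ [0, R θ]`, `θ ∈ [0, 2π]`. -/
def radialSet (R : ℝ → ℝ≥0) : Set Plane :=
  {p | ∃ r θ : ℝ, r ∈ Set.Icc 0 (R θ : ℝ) ∧ θ ∈ Set.Icc 0 (2 * Real.pi) ∧
    p = !₂[r * Real.cos θ, r * Real.sin θ]}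

/-- How a mark `m`, an element of the measurable mark space `𝕄`, describes an object:
its shape (a random closed convex set), whether it is a sensor, and, if so, the position of the
sensor relative to the centre of the object and the maximal sensing range in each direction.
The three components may depend on each other in an arbitrary way through `m`. -/
structure ObjectModel (𝕄 : Type*) [MeasurableSpace 𝕄] where
  /-- the shape `A`, referenced to the origin -/
  shape : 𝕄 → Set Plane
  /-- the marks of the objects that are sensors -/
  sensors : Set 𝕄
  /-- the sensor offset `Y` -/
  offset : 𝕄 → Plane
  /-- the maximal sensing range, as a function of the direction -/
  range : 𝕄 → ℝ → ℝ≥0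
  isClosed_shape : ∀ m, IsClosed (shape m)
  convex_shape : ∀ m, Convex ℝ (shape m)
  /-- measurability of `shape` as a random closed set -/
  measurableSet_hit : ∀ K : Set Plane, IsCompact K → MeasurableSet {m | (shape m ∩ K).Nonempty}
  measurableSet_sensors : MeasurableSet sensors
  measurable_offset : Measurable offset
  measurable_range : Measurable (Function.uncurry range)
  /-- the sensor is mounted on its object -/
  offset_mem : ∀ m ∈ sensors, offset m ∈ shape m
  /-- the convention for objects that are not sensors -/
  offset_eq_zero : ∀ m, m ∉ sensors → offset m = 0

namespace ObjectModel

variable {𝕄 : Type*} [MeasurableSpace 𝕄] (D : ObjectModel 𝕄)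

open Classical in
/-- The radial sensing support, referenced to the location of the sensor; it is empty for an object
that is not a sensor. -/
def support (m : 𝕄) : Set Plane :=
  if m ∈ D.sensors then radialSet (D.range m) else ∅

/-- The region occupied by an object with centre `p` and mark `m`. -/
def region (p : Plane) (m : 𝕄) : Set Plane := {p} + D.shape m

/-- The region occupied by the objects other than the `i`-th, in the configuration with centres `x`
and marks `m`. -/
def environmentExcept (x : ℕ → Plane) (m : ℕ → 𝕄) (i : ℕ) : Set Plane :=
  ⋃ j ∈ {j : ℕ | j ≠ i}, D.region (x j) (m j)

/-- The coverage set of the `i`-th object in the configuration with centres `x` and marks `m`. -/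
def coverageSet (x : ℕ → Plane) (m : ℕ → 𝕄) (i : ℕ) : Set Plane :=
  {z | z ∈ {x i + D.offset (m i)} + D.support (m i) ∧
    (z ∈ D.region (x i) (m i) ∨
      segment ℝ (x i + D.offset (m i)) z ∩ D.environmentExcept x m i ⊆ {z})}

/-- The part of the sensing support of the `i`-th object, outside of this object, to which the
closed line of sight meets no other object. -/
def clearSet (x : ℕ → Plane) (m : ℕ → 𝕄) (i : ℕ) : Set Plane :=
  {z | z ∈ ({x i + D.offset (m i)} + D.support (m i)) \ D.region (x i) (m i) ∧
    segment ℝ (x i + D.offset (m i)) z ∩ D.environmentExcept x m i = ∅}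

end ObjectModel

/-- The number of points of the sequence `X` in `B`. -/
def pointCount {Ω : Type*} (X : ℕ → Ω → Plane) (B : Set Plane) (ω : Ω) : ℝ≥0∞ :=
  ∑' i, B.indicator 1 (X i ω)

/-- `X` enumerates the points of a homogeneous Poisson point process of intensity `lam`: counts of
bounded Borel sets are Poisson, and counts of disjoint ones are independent. -/
structure IsPoissonProcess {Ω : Type*} [MeasurableSpace Ω] (P : Measure Ω)
    (X : ℕ → Ω → Plane) (lam : ℝ≥0) : Prop where
  measurable : ∀ i, Measurable (X i)
  hasLaw_pointCount : ∀ B : Set Plane, MeasurableSet B → Bornology.IsBounded B →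
    HasLaw (pointCount X B)
      ((poissonMeasure (lam * (volume B).toNNReal)).map (fun n : ℕ => (n : ℝ≥0∞))) P
  iIndepFun_pointCount : ∀ (n : ℕ) (B : Fin n → Set Plane), (∀ k, MeasurableSet (B k)) →
    (∀ k, Bornology.IsBounded (B k)) → Pairwise (fun k l => Disjoint (B k) (B l)) →
    iIndepFun (fun k => pointCount X (B k)) P

/-- The points `X i` with the marks `M i` form an independently marked homogeneous Poisson process
of intensity `lam`: the marks are independent with the common law `F`, and the family of marks
is independent of the points. -/
structure IsMarkedPoissonProcess {Ω 𝕄 : Type*} [MeasurableSpace Ω] [MeasurableSpace 𝕄]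
    (P : Measure Ω) (X : ℕ → Ω → Plane) (M : ℕ → Ω → 𝕄) (lam : ℝ≥0) (F : Measure 𝕄) : Prop where
  points : IsPoissonProcess P X lam
  measurable_mark : ∀ i, Measurable (M i)
  hasLaw_mark : ∀ i, HasLaw (M i) F P
  iIndepFun_mark : iIndepFun M P
  indepFun_points_marks : IndepFun (fun ω i => X i ω) (fun ω i => M i ω) P

open Classical in
/-- The sum of `f` over the objects with centre in `B` and mark in `T`, where `f` is evaluated at
the configuration shifted such that the object under consideration has its centre at the origin. -/
def shiftedSum {𝕄 : Type*} (T : Set 𝕄) (B : Set Plane)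
    (f : (ℕ → Plane) → (ℕ → 𝕄) → ℕ → ℝ≥0∞) (x : ℕ → Plane) (m : ℕ → 𝕄) : ℝ≥0∞ :=
  ∑' i, if x i ∈ B ∧ m i ∈ T then f (fun j => x j - x i) m i else 0

/-- The Palm mean of `f` for a typical object with mark in `T`, in terms of the window `B`:
the mean sum of `f` over such objects with centre in `B` (each time after shifting the object to the
origin), divided by the mean number of such objects. -/
def palmMean {Ω 𝕄 : Type*} [MeasurableSpace Ω] (P : Measure Ω) (X : ℕ → Ω → Plane)
    (M : ℕ → Ω → 𝕄) (T : Set 𝕄) (B : Set Plane)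
    (f : (ℕ → Plane) → (ℕ → 𝕄) → ℕ → ℝ≥0∞) : ℝ≥0∞ :=
  (∫⁻ ω, shiftedSum T B f (fun i => X i ω) (fun i => M i ω) ∂P) /
    (∫⁻ ω, shiftedSum T B (fun _ _ _ => 1) (fun i => X i ω) (fun i => M i ω) ∂P)

/-- `exp (-t)` for `t ∈ [0, ∞]`, with `exp (-∞) = 0`. -/
def expNeg (t : ℝ≥0∞) : ℝ≥0∞ := EReal.exp (-(t : EReal))

end

/-! The coverage area splits along the sensor's own shape. Inside the shape no other object matters,
and independence of points and marks gives the first term. Outside it, allowing the line of sight to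
touch an obstacle at its endpoint only adds a null set (`volume_visible_diff_clear`): contracting
towards the sensor by any factor `t < 1` sends the visible points other than the sensor to points
with a fully clear line of sight, and `t → 1` compares the areas. It remains to find the mean area
of the clear set.

Fix the centres. By independence of the marks, the line of sight of object `i`, with its mark and
the location given, is clear with probability `∏ q(X_j - X_i)` over `j ≠ i`, where `q` is
`missProb`. With `h = -log q` this is `exp(-∑ h(X_j - X_i))`, where `h = ∞` is allowed. The Mecke
formula `lintegral_tsum_expNeg` evaluates the mean of the sum of these over the points in `B` as `λ
|B| exp(-λ ∫ (1 - q))`. By Tonelli, `∫ (1 - q)` is the mean area of the segment dilated by the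
reflected shape (`lintegral_one_sub_missProb`). Dividing by the mean number of sensors, `λ |B|
F(sensors)`, leaves the conditional law of the mark.

The Mecke formula is derived from the Poisson counts alone. For functions constant on the cells of a
countable partition it reduces to independent Poisson variables. For upper semicontinuous `h`, the
suprema over ever smaller cells converge to `h` at every point, and this semicontinuity holds for
`-log q` because shapes are closed and segments compact. -/

open Filter Topology

/-! ### The function `expNeg` -/

@[simp] lemma expNeg_zero : expNeg 0 = 1 := by simp [expNeg]

@[simp] lemma expNeg_top : expNeg ∞ = 0 := by simp [expNeg]

lemma expNeg_coe (r : ℝ≥0) : expNeg r = ENNReal.ofReal (Real.exp (-r)) := by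
  have : -(((r : ℝ≥0∞) : EReal)) = ((-(r : ℝ) : ℝ) : EReal) := rfl
  rw [expNeg, this, EReal.exp_coe]

lemma expNeg_antitone : Antitone expNeg := fun s t h => by
  unfold expNeg
  rw [EReal.exp_le_exp_iff, EReal.neg_le_neg_iff]
  exact_mod_cast h

lemma expNeg_le_one (t : ℝ≥0∞) : expNeg t ≤ 1 := by
  simpa using expNeg_antitone (zero_le (a := t))

lemma expNeg_ne_top (t : ℝ≥0∞) : expNeg t ≠ ∞ := ((expNeg_le_one t).trans_lt (by simp)).ne

lemma expNeg_ne_zero {t : ℝ≥0∞} (ht : t ≠ ∞) : expNeg t ≠ 0 := by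
  lift t to ℝ≥0 using ht
  rw [expNeg_coe]
  simp [Real.exp_pos]

lemma continuous_expNeg : Continuous expNeg :=
  ENNReal.continuous_exp.comp (continuous_neg.comp continuous_coe_ennreal_ereal)

@[fun_prop]
lemma measurable_expNeg : Measurable expNeg := continuous_expNeg.measurable

lemma expNeg_add (s t : ℝ≥0∞) : expNeg (s + t) = expNeg s * expNeg t := by
  unfold expNeg
  rw [EReal.coe_ennreal_add, EReal.neg_add (Or.inl (by simp)) (Or.inr (by simp)), sub_eq_add_neg,
    EReal.exp_add]

lemma expNeg_sum {ι : Type*} (s : Finset ι) (f : ι → ℝ≥0∞) :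
    expNeg (∑ i ∈ s, f i) = ∏ i ∈ s, expNeg (f i) := by
  classical
  induction s using Finset.induction_on with
  | empty => simp
  | insert a s ha ih => rw [Finset.sum_insert ha, Finset.prod_insert ha, expNeg_add, ih]

lemma tendsto_prod_expNeg (f : ℕ → ℝ≥0∞) :
    Tendsto (fun n => ∏ j ∈ Finset.range n, expNeg (f j)) atTop (𝓝 (expNeg (∑' j, f j))) := by
  simp_rw [← expNeg_sum]
  exact (continuous_expNeg.tendsto _).comp ENNReal.summable.hasSum.tendsto_sum_nat

/-- The function inverse to `expNeg`. -/
noncomputable def negLog (q : ℝ≥0∞) : ℝ≥0∞ := (-ENNReal.log q).toENNReal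

lemma expNeg_negLog {q : ℝ≥0∞} (hq : q ≤ 1) : expNeg (negLog q) = q := by
  unfold expNeg negLog
  rw [EReal.coe_toENNReal (by simpa using hq), neg_neg, ENNReal.exp_log]

lemma continuous_negLog : Continuous negLog :=
  EReal.continuous_toENNReal.comp (continuous_neg.comp ENNReal.continuous_log)

@[fun_prop]
lemma measurable_negLog : Measurable negLog := continuous_negLog.measurable

lemma negLog_lt {q c : ℝ≥0∞} (hq : q ≤ 1) : negLog q < c ↔ expNeg c < q := by
  have h : StrictAnti expNeg := by
    refine expNeg_antitone.strictAnti_of_injective fun s t hst => ?_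
    unfold expNeg at hst
    have := EReal.exp_strictMono.injective hst
    simpa using this
  conv_rhs => rw [← expNeg_negLog hq]
  rw [h.lt_iff_gt]

/-! ### Expectations under the Poisson law -/

lemma lintegral_poissonMeasure (r : ℝ≥0) (f : ℕ → ℝ≥0∞) :
    ∫⁻ n, f n ∂poissonMeasure r =
      ∑' n : ℕ, ENNReal.ofReal (Real.exp (-r) * r ^ n / n.factorial) * f n := by
  rw [poissonMeasure, lintegral_sum_measure]
  simp

/-- Size-biasing: `n` times the Poisson weight of `n` is `r` times the weight of `n - 1`. This is
the germ of the Mecke formula. -/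
lemma lintegral_natCast_mul_poissonMeasure (r : ℝ≥0) (f : ℕ → ℝ≥0∞) :
    ∫⁻ n, n * f n ∂poissonMeasure r = r * ∫⁻ n, f (n + 1) ∂poissonMeasure r := by
  rw [lintegral_poissonMeasure, lintegral_poissonMeasure, tsum_eq_zero_add' ENNReal.summable,
    ← ENNReal.tsum_mul_left]
  simp only [Nat.cast_zero, zero_mul, mul_zero, zero_add]
  refine tsum_congr fun n => ?_
  rw [← mul_assoc, ← mul_assoc]
  congr 1
  rw [← ENNReal.ofReal_natCast, ← ENNReal.ofReal_coe_nnreal, ← ENNReal.ofReal_mul (by positivity),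
    ← ENNReal.ofReal_mul (by positivity)]
  congr 1
  rw [Nat.factorial_succ]
  push_cast
  field_simp
  ring

lemma lintegral_expNeg_mul_poissonMeasure (r g : ℝ≥0) :
    ∫⁻ n, expNeg (g * n) ∂poissonMeasure r = expNeg (r * (1 - expNeg g)) := by
  have h1 : (r : ℝ≥0∞) * (1 - expNeg g) =
      ((r * (Real.toNNReal (1 - Real.exp (-g))) : ℝ≥0) : ℝ≥0∞) := by
    rw [expNeg_coe, ← ENNReal.ofReal_one, ← ENNReal.ofReal_sub _ (Real.exp_pos _).le]
    simp [ENNReal.ofReal]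
  rw [h1, expNeg_coe, lintegral_poissonMeasure]
  have h2 : 0 ≤ 1 - Real.exp (-g) := by simp
  have h3 : HasSum (fun n : ℕ => Real.exp (-r) * r ^ n / n.factorial * Real.exp (-(g * n)))
      (Real.exp (-r) * Real.exp (r * Real.exp (-g))) := by
    have h := (NormedSpace.expSeries_div_hasSum_exp (r * Real.exp (-g) : ℝ)).mul_left
      (Real.exp (-r))
    rw [← Real.exp_eq_exp_ℝ] at h
    convert! h using 2 with n
    rw [mul_pow, ← Real.exp_nat_mul]
    ring_nf
  have h4 (n : ℕ) : ENNReal.ofReal (Real.exp (-r) * r ^ n / n.factorial) * expNeg (g * n) =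
      ENNReal.ofReal (Real.exp (-r) * r ^ n / n.factorial * Real.exp (-(g * n))) := by
    have : (g : ℝ≥0∞) * n = ((g * n : ℝ≥0) : ℝ≥0∞) := by simp
    rw [this, expNeg_coe, ENNReal.ofReal_mul (by positivity)]
    simp
  simp_rw [h4]
  rw [← ENNReal.ofReal_tsum_of_nonneg (fun n => by positivity) h3.summable, h3.tsum_eq,
    ← Real.exp_add]
  congr 2
  push_cast
  rw [Real.coe_toNNReal _ h2]
  ring

/-- The shift from `n` to `n + 1` splits off one factor `expNeg g`, the contribution of the
distinguished point; the rest is the Laplace transform. -/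
lemma lintegral_natCast_mul_expNeg_poissonMeasure (r g : ℝ≥0) :
    ∫⁻ n, n * expNeg (g * n) ∂poissonMeasure r =
      r * (expNeg g * expNeg (r * (1 - expNeg g))) := by
  rw [lintegral_natCast_mul_poissonMeasure, ← lintegral_expNeg_mul_poissonMeasure,
    
    ← lintegral_const_mul (expNeg g) (by fun_prop)]
  congr 1
  refine lintegral_congr fun n => ?_
  rw [← expNeg_add]
  push_cast
  ring_nf

/-! ### Sums over the points of a Poisson process, with one point left out -/

lemma ENNReal.tendsto_tsum_of_monotone {f : ℕ → ℕ → ℝ≥0∞} {g : ℕ → ℝ≥0∞}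
    (hf : ∀ j, Monotone fun n => f n j) (h : ∀ j, Tendsto (fun n => f n j) atTop (𝓝 (g j))) :
    Tendsto (fun n => ∑' j, f n j) atTop (𝓝 (∑' j, g j)) := by
  simp_rw [← lintegral_count]
  exact lintegral_tendsto_of_tendsto_of_monotone (fun n => (measurable_of_countable _).aemeasurable)
    (Eventually.of_forall hf) (Eventually.of_forall h)

lemma ENNReal.tendsto_tsum_of_le {f : ℕ → ℕ → ℝ≥0∞} {g b : ℕ → ℝ≥0∞}
    (hf : ∀ n j, f n j ≤ b j) (hb : ∑' j, b j ≠ ∞)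
    (h : ∀ j, Tendsto (fun n => f n j) atTop (𝓝 (g j))) :
    Tendsto (fun n => ∑' j, f n j) atTop (𝓝 (∑' j, g j)) := by
  simp_rw [← lintegral_count] at hb ⊢
  exact tendsto_lintegral_of_dominated_convergence b (fun n => measurable_of_countable _)
    (fun n => Eventually.of_forall (hf n)) hb (Eventually.of_forall h)

/-- Dominated convergence twice: over `i` for almost every `ω`, where the dominating sum is finite
because its mean is, and then over `ω`. -/
lemma tendsto_lintegral_tsum_of_le {Ω : Type*} [MeasurableSpace Ω] {P : Measure Ω}
    {f : ℕ → ℕ → Ω → ℝ≥0∞} {g b : ℕ → Ω → ℝ≥0∞} (hf : ∀ n i ω, f n i ω ≤ b i ω)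
    (hfm : ∀ n i, Measurable (f n i)) (hbm : ∀ i, Measurable (b i))
    (hb : ∫⁻ ω, ∑' i, b i ω ∂P ≠ ∞)
    (h : ∀ᵐ ω ∂P, ∀ i, Tendsto (fun n => f n i ω) atTop (𝓝 (g i ω))) :
    Tendsto (fun n => ∫⁻ ω, ∑' i, f n i ω ∂P) atTop (𝓝 (∫⁻ ω, ∑' i, g i ω ∂P)) := by
  refine tendsto_lintegral_of_dominated_convergence (fun ω => ∑' i, b i ω)
    (fun n => Measurable.tsum (hfm n))
    (fun n => Eventually.of_forall fun ω => ENNReal.tsum_le_tsum fun i => hf n i ω) hb ?_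
  filter_upwards [h, ae_lt_top (Measurable.tsum hbm) hb] with ω h1 h2
  exact ENNReal.tendsto_tsum_of_le (fun n i => hf n i ω) h2.ne h1

lemma measurable_ite_tsum {α : Type*} [MeasurableSpace α] (i : ℕ) {f : ℕ → α → ℝ≥0∞}
    (hf : ∀ j, Measurable (f j)) : Measurable fun a => ∑' j, if j = i then 0 else f j a := by
  refine Measurable.tsum fun j => ?_
  split_ifs
  · exact measurable_const
  · exact hf j

lemma tsum_comp_eq_sum_pointCount {Ω : Type*} {X : ℕ → Ω → Plane} {c : Plane → ℕ}
    (n : ℕ) (G : ℕ → ℝ≥0∞) (ω : Ω) :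
    ∑' j, (if c (X j ω) < n then G (c (X j ω)) else 0) =
      ∑ b : Fin n, G b * pointCount X (c ⁻¹' {(b : ℕ)}) ω := by
  simp_rw [pointCount, ← ENNReal.tsum_mul_left]
  rw [← Summable.tsum_finsetSum (fun _ _ => ENNReal.summable)]
  refine tsum_congr fun j => ?_
  have h := Fin.sum_univ_eq_sum_range (fun b => G b * (c ⁻¹' {b}).indicator 1 (X j ω)) n
  rw [h]
  split_ifs with hn
  · rw [Finset.sum_eq_single_of_mem (c (X j ω)) (Finset.mem_range.2 hn) fun b _ hb => by
      rw [Set.indicator_of_notMem (fun h' => hb h'.symm), mul_zero],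
      Set.indicator_of_mem (by rfl), Pi.one_apply, mul_one]
  · refine (Finset.sum_eq_zero fun b hb => ?_).symm
    rw [Set.indicator_of_notMem (fun h' => hn (by
      rw [show c (X j ω) = b from h']; simpa using hb)), mul_zero]

/-! ### The Mecke formula for a countable partition into bounded cells -/

namespace IsPoissonProcess

variable {Ω : Type*} [MeasurableSpace Ω] {P : Measure Ω} {X : ℕ → Ω → Plane} {lam : ℝ≥0}

lemma measurable_indicator (hX : IsPoissonProcess P X lam) {B : Set Plane} (hB : MeasurableSet B)
    (i : ℕ) : Measurable fun ω => B.indicator (1 : Plane → ℝ≥0∞) (X i ω) :=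
  (measurable_one.indicator hB).comp (hX.measurable i)

lemma measurable_pointCount (hX : IsPoissonProcess P X lam) {B : Set Plane}
    (hB : MeasurableSet B) : Measurable (pointCount X B) :=
  Measurable.tsum fun i => hX.measurable_indicator hB i

lemma lintegral_comp_pointCount (hX : IsPoissonProcess P X lam) {B : Set Plane}
    (hB : MeasurableSet B) (hB' : Bornology.IsBounded B) {f : ℝ≥0∞ → ℝ≥0∞} (hf : Measurable f) :
    ∫⁻ ω, f (pointCount X B ω) ∂P =
      ∫⁻ n, f (n : ℝ≥0∞) ∂poissonMeasure (lam * (volume B).toNNReal) := by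
  rw [(hX.hasLaw_pointCount B hB hB').lintegral_comp hf.aemeasurable,
    lintegral_map hf (measurable_of_countable _)]

lemma ae_pointCount_lt_top (hX : IsPoissonProcess P X lam) {B : Set Plane}
    (hB : MeasurableSet B) (hB' : Bornology.IsBounded B) : ∀ᵐ ω ∂P, pointCount X B ω < ∞ := by
  have h := hX.lintegral_comp_pointCount hB hB' (f := Set.indicator {∞} 1)
    (measurable_one.indicator (measurableSet_singleton _))
  have h2 : ∫⁻ ω, Set.indicator {∞} 1 (pointCount X B ω) ∂P = 0 := by
    rw [h]; simp
  have h3 : Measurable fun ω => Set.indicator {∞} (1 : ℝ≥0∞ → ℝ≥0∞) (pointCount X B ω) :=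
    (measurable_one.indicator (measurableSet_singleton _)).comp (hX.measurable_pointCount hB)
  filter_upwards [(lintegral_eq_zero_iff h3).1 h2] with ω hω
  rw [lt_top_iff_ne_top]
  intro h4
  simp [h4] at hω

section Cells

variable {c : Plane → ℕ}

/-- With finitely many cells everything is a function of independent Poisson counts, so the mean
factors over the cells. -/
lemma lintegral_tsum_cell_finite (hX : IsPoissonProcess P X lam) (hc : Measurable c)
    (hcb : ∀ b, Bornology.IsBounded (c ⁻¹' {b})) (n : ℕ) (G : ℕ → ℝ≥0) (a : Fin n) :
    ∫⁻ ω, ∑' i, (c ⁻¹' {(a : ℕ)}).indicator 1 (X i ω) *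
      expNeg (∑' j, if j = i then 0 else
        if c (X j ω) < n then (G (c (X j ω)) : ℝ≥0∞) else 0) ∂P =
      lam * volume (c ⁻¹' {(a : ℕ)}) * expNeg (∑ b ∈ Finset.range n,
        lam * volume (c ⁻¹' {b}) * (1 - expNeg (G b))) := by
  have hm (b : ℕ) : MeasurableSet (c ⁻¹' {b}) := hc (measurableSet_singleton b)
  have hind := hX.iIndepFun_pointCount n (fun b => c ⁻¹' {(b : ℕ)}) (fun b => hm b)
    (fun b => hcb b) (fun k l hkl => Disjoint.preimage _ (by
      simpa [Fin.ext_iff, eq_comm] using hkl))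
  have hvol (b : ℕ) : ((lam * (volume (c ⁻¹' {b})).toNNReal : ℝ≥0) : ℝ≥0∞) =
      lam * volume (c ⁻¹' {b}) := by
    rw [ENNReal.coe_mul, ENNReal.coe_toNNReal (hcb b).measure_lt_top.ne]
  -- The product of the `φ b` at the counts `N_b` is `N_a exp(-∑ G_b N_b)`; the factor `N_a` counts
  -- the choices of the distinguished point in cell `a`.
  let φ (b : Fin n) (t : ℝ≥0∞) : ℝ≥0∞ := (if b = a then t else 1) * expNeg (G b * t)
  have hφ (b : Fin n) : Measurable (φ b) := by
    dsimp only [φ]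
    split_ifs <;> fun_prop
  have hcell (b : Fin n) : ∫⁻ ω, φ b (pointCount X (c ⁻¹' {(b : ℕ)}) ω) ∂P =
      (if b = a then lam * volume (c ⁻¹' {(a : ℕ)}) * expNeg (G a) else 1) *
        expNeg (lam * volume (c ⁻¹' {(b : ℕ)}) * (1 - expNeg (G b))) := by
    rw [hX.lintegral_comp_pointCount (hm b) (hcb b) (hφ b), ← hvol]
    dsimp only [φ]
    split_ifs with hba
    · subst hba
      rw [lintegral_natCast_mul_expNeg_poissonMeasure, ← hvol, mul_assoc]
    · simp_rw [one_mul]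
      rw [lintegral_expNeg_mul_poissonMeasure, hvol]
  have hprod := lintegral_prod_eq_prod_lintegral_of_indepFun Finset.univ
    (fun b ω => φ b (pointCount X (c ⁻¹' {(b : ℕ)}) ω))
    (hind.comp φ hφ) (fun b => (hφ b).comp (hX.measurable_pointCount (hm b)))
  simp_rw [hcell] at hprod
  have hpt (ω : Ω) : ∏ b : Fin n, φ b (pointCount X (c ⁻¹' {(b : ℕ)}) ω) =
      expNeg (G a) * ∑' i, (c ⁻¹' {(a : ℕ)}).indicator 1 (X i ω) *
        expNeg (∑' j, if j = i then 0 else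
          if c (X j ω) < n then (G (c (X j ω)) : ℝ≥0∞) else 0) := by
    dsimp only [φ]
    rw [Finset.prod_mul_distrib, Finset.prod_ite_eq' Finset.univ a, if_pos (Finset.mem_univ _),
      ← expNeg_sum, ← tsum_comp_eq_sum_pointCount n (fun b => (G b : ℝ≥0∞)), pointCount,
      ← ENNReal.tsum_mul_right, ← ENNReal.tsum_mul_left]
    refine tsum_congr fun i => ?_
    by_cases hi : c (X i ω) = a
    · rw [ENNReal.summable.tsum_eq_add_tsum_ite' i, expNeg_add]
      simp [hi]
    · simp [hi]
  simp_rw [hpt] at hprod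
  rw [lintegral_const_mul' _ _ (expNeg_ne_top _), Finset.prod_mul_distrib,
    Finset.prod_ite_eq' Finset.univ a, if_pos (Finset.mem_univ _), ← expNeg_sum,
    Fin.sum_univ_eq_sum_range
      (fun b => lam * volume (c ⁻¹' {b}) * (1 - expNeg (G b)))] at hprod
  -- In `hprod` the distinguished point also contributes to the exponent, hence the extra factor
  -- `expNeg (G a)`. It can be cancelled because `G a` is finite, which is why `G` is `ℝ≥0`-valued
  -- here.
  refine (ENNReal.mul_right_inj (expNeg_ne_zero ENNReal.coe_ne_top) (expNeg_ne_top (G a))).1 ?_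
  rw [hprod]
  ring

lemma lintegral_pointCount_cell (hX : IsPoissonProcess P X lam) (hc : Measurable c)
    (hcb : ∀ b, Bornology.IsBounded (c ⁻¹' {b})) (a : ℕ) :
    ∫⁻ ω, ∑' i, (c ⁻¹' {a}).indicator 1 (X i ω) ∂P = lam * volume (c ⁻¹' {a}) := by
  simpa using hX.lintegral_tsum_cell_finite hc hcb (a + 1) (fun _ => 0) ⟨a, by simp⟩

lemma lintegral_tsum_cell (hX : IsPoissonProcess P X lam) (hc : Measurable c)
    (hcb : ∀ b, Bornology.IsBounded (c ⁻¹' {b})) (G : ℕ → ℝ≥0∞) (a : ℕ) :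
    ∫⁻ ω, ∑' i, (c ⁻¹' {a}).indicator 1 (X i ω) *
      expNeg (∑' j, if j = i then 0 else G (c (X j ω))) ∂P =
      lam * volume (c ⁻¹' {a}) * expNeg (lam * ∫⁻ p, (1 - expNeg (G (c p)))) := by
  -- `H` makes the values finite and `K` keeps finitely many cells. Both cut-offs increase to `G`,
  -- so sums in exponents converge monotonically, and the outer sums are dominated by the count of
  -- cell `a`.
  let H (n b : ℕ) : ℝ≥0 := (min (G b) n).toNNReal
  have hH (n b : ℕ) : (H n b : ℝ≥0∞) = min (G b) n := ENNReal.coe_toNNReal (by simp)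
  let K (n b : ℕ) : ℝ≥0∞ := if b < n then (H n b : ℝ≥0∞) else 0
  have hKmono (b : ℕ) : Monotone fun n => K n b := by
    intro n m hnm
    dsimp only [K]
    split_ifs with h1 h2 h2
    · rw [hH, hH]; gcongr
    · omega
    · simp
    · simp
  have hKlim (b : ℕ) : Tendsto (fun n => K n b) atTop (𝓝 (G b)) := by
    have h : Tendsto (fun n : ℕ => min (G b) n) atTop (𝓝 (min (G b) ∞)) :=
      tendsto_const_nhds.min ENNReal.tendsto_nat_nhds_top
    rw [min_eq_left le_top] at h
    refine h.congr' ?_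
    filter_upwards [eventually_gt_atTop b] with n hn
    simp [K, hn, hH]
  have hcm (i : ℕ) : Measurable fun ω => c (X i ω) := hc.comp (hX.measurable i)
  have hKm (n j : ℕ) : Measurable fun ω => K n (c (X j ω)) :=
    (measurable_of_countable (K n)).comp (hcm j)
  have hlim1 := tendsto_lintegral_tsum_of_le (P := P)
    (f := fun n i ω => (c ⁻¹' {a}).indicator 1 (X i ω) *
      expNeg (∑' j, if j = i then 0 else K n (c (X j ω))))
    (g := fun i ω => (c ⁻¹' {a}).indicator 1 (X i ω) *
      expNeg (∑' j, if j = i then 0 else G (c (X j ω))))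
    (b := fun i ω => (c ⁻¹' {a}).indicator 1 (X i ω))
    (fun n i ω => mul_le_of_le_one_right' (expNeg_le_one _))
    (fun n i => (hX.measurable_indicator (hc (measurableSet_singleton a)) i).mul
      (measurable_expNeg.comp (measurable_ite_tsum i (hKm n))))
    (hX.measurable_indicator (hc (measurableSet_singleton a)))
    (by
      rw [hX.lintegral_pointCount_cell hc hcb]
      exact ENNReal.mul_ne_top ENNReal.coe_ne_top (hcb a).measure_lt_top.ne)
    (Eventually.of_forall fun ω i => by
      refine ENNReal.Tendsto.const_mul ((continuous_expNeg.tendsto _).comp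
        (ENNReal.tendsto_tsum_of_monotone (fun j => ?_) fun j => ?_)) (Or.inr ?_)
      · by_cases hj : j = i
        · simpa [hj] using monotone_const
        · simpa [hj] using hKmono _
      · by_cases hj : j = i
        · simp [hj]
        · simpa [hj] using hKlim _
      · by_cases hi : c (X i ω) = a <;> simp [hi])
  have hlim2 : Tendsto (fun n => ∑' b, lam * volume (c ⁻¹' {b}) * (1 - expNeg (K n b))) atTop
      (𝓝 (∑' b, lam * volume (c ⁻¹' {b}) * (1 - expNeg (G b)))) := by
    refine ENNReal.tendsto_tsum_of_monotone (fun b n m hnm => ?_) fun b => ?_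
    · dsimp only
      gcongr
      exact expNeg_antitone (hKmono b hnm)
    · refine ENNReal.Tendsto.const_mul ?_ (Or.inr (ENNReal.mul_ne_top ENNReal.coe_ne_top
        (hcb b).measure_lt_top.ne))
      exact ((ENNReal.continuous_sub_left ENNReal.one_ne_top).tendsto _).comp
        ((continuous_expNeg.tendsto _).comp (hKlim b))
  have hvol : lam * ∫⁻ p, (1 - expNeg (G (c p))) =
      ∑' b, lam * volume (c ⁻¹' {b}) * (1 - expNeg (G b)) := by
    rw [← lintegral_map (f := fun b => 1 - expNeg (G b)) (measurable_of_countable _) hc,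
      lintegral_countable', ← ENNReal.tsum_mul_left]
    refine tsum_congr fun b => ?_
    rw [Measure.map_apply hc (measurableSet_singleton b)]
    ring
  rw [hvol]
  refine tendsto_nhds_unique hlim1 ?_
  have hlim3 := ENNReal.Tendsto.const_mul (a := lam * volume (c ⁻¹' {a}))
    ((continuous_expNeg.tendsto _).comp hlim2) (Or.inr (ENNReal.mul_ne_top ENNReal.coe_ne_top
        (hcb a).measure_lt_top.ne))
  refine hlim3.congr' ?_
  filter_upwards [eventually_gt_atTop a] with n hn
  have := hX.lintegral_tsum_cell_finite hc hcb n (H n) ⟨a, hn⟩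
  dsimp only at this
  simp only [K]
  rw [this]
  dsimp only [Function.comp]
  congr 2
  rw [tsum_eq_sum (s := Finset.range n) (fun b hb => by
    rw [if_neg (by simpa using hb)]; simp)]
  refine Finset.sum_congr rfl fun b hb => ?_
  rw [if_pos (by simpa using hb)]

/-- The Mecke formula for functionals that depend only on the cells of the points. -/
lemma lintegral_tsum_cells (hX : IsPoissonProcess P X lam) (hc : Measurable c)
    (hcb : ∀ b, Bornology.IsBounded (c ⁻¹' {b})) (G : ℕ → ℕ → ℝ≥0∞) (A : Set ℕ) :
    ∫⁻ ω, ∑' i, (c ⁻¹' A).indicator 1 (X i ω) *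
      expNeg (∑' j, if j = i then 0 else G (c (X i ω)) (c (X j ω))) ∂P =
      lam * ∫⁻ x in c ⁻¹' A, expNeg (lam * ∫⁻ p, (1 - expNeg (G (c x) (c p)))) := by
  classical
  have hcm (i : ℕ) : Measurable fun ω => c (X i ω) := hc.comp (hX.measurable i)
  have h1 (ω : Ω) : ∑' i, (c ⁻¹' A).indicator 1 (X i ω) *
      expNeg (∑' j, if j = i then 0 else G (c (X i ω)) (c (X j ω))) =
      ∑' a, A.indicator 1 a * ∑' i, (c ⁻¹' {a}).indicator 1 (X i ω) *
        expNeg (∑' j, if j = i then 0 else G a (c (X j ω))) := by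
    simp_rw [← ENNReal.tsum_mul_left]
    rw [ENNReal.tsum_comm]
    refine tsum_congr fun i => ?_
    refine Eq.symm ((tsum_eq_single (c (X i ω)) fun a ha => ?_).trans ?_)
    · simp [Ne.symm ha]
    · simp [Set.indicator_apply]
  simp_rw [h1]
  have hGm (a j : ℕ) : Measurable fun ω => G a (c (X j ω)) :=
    (measurable_of_countable (G a)).comp (hcm j)
  have hmeas (a : ℕ) : Measurable fun ω => ∑' i, (c ⁻¹' {a}).indicator 1 (X i ω) *
        expNeg (∑' j, if j = i then 0 else G a (c (X j ω))) :=
    Measurable.tsum fun i =>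
      (hX.measurable_indicator (hc (measurableSet_singleton a)) i).mul
        (measurable_expNeg.comp (measurable_ite_tsum i (hGm a)))
  rw [lintegral_tsum (fun a => ((hmeas a).const_mul _).aemeasurable)]
  have h3 (a : ℕ) : ∫⁻ ω, A.indicator 1 a * ∑' i, (c ⁻¹' {a}).indicator 1 (X i ω) *
      expNeg (∑' j, if j = i then 0 else G a (c (X j ω))) ∂P = A.indicator 1 a *
      (lam * volume (c ⁻¹' {a}) * expNeg (lam * ∫⁻ p, (1 - expNeg (G a (c p))))) := by
    rw [lintegral_const_mul _ (hmeas a), hX.lintegral_tsum_cell hc hcb (G a) a]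
  simp_rw [h3]
  rw [← lintegral_indicator (hc (Set.to_countable A).measurableSet)]
  have h2 : ∫⁻ x, (c ⁻¹' A).indicator
      (fun x => expNeg (lam * ∫⁻ p, (1 - expNeg (G (c x) (c p))))) x =
      ∫⁻ x, A.indicator (fun a => expNeg (lam * ∫⁻ p, (1 - expNeg (G a (c p))))) (c x) := rfl
  rw [h2, ← lintegral_map (measurable_of_countable _) hc, lintegral_countable',
    ← ENNReal.tsum_mul_left]
  refine tsum_congr fun a => ?_
  rw [Measure.map_apply hc (measurableSet_singleton a)]
  by_cases ha : a ∈ A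
  · simp only [Set.indicator_of_mem ha, Pi.one_apply]
    ring
  · simp [ha]

end Cells

end IsPoissonProcess

/-! ### The Mecke formula for translation-covariant multiplicative functionals -/

/-- A cell is given by the first member of a dense sequence within `ε / 2`, together with membership
in `B` and in `W`. Thus cells are small and both sets are unions of cells. -/
lemma exists_measurable_cells {E : Type*} [MetricSpace E] [TopologicalSpace.SeparableSpace E]
    [Nonempty E] [MeasurableSpace E] [OpensMeasurableSpace E] {ε : ℝ} (hε : 0 < ε) {B W : Set E}
    (hB : MeasurableSet B) (hW : MeasurableSet W) :
    ∃ c : E → ℕ, Measurable c ∧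
      ∀ p p', c p = c p' → dist p p' < ε ∧ (p ∈ B ↔ p' ∈ B) ∧ (p ∈ W ↔ p' ∈ W) := by
  classical
  have hex (p : E) : ∃ k, dist p (TopologicalSpace.denseSeq E k) < ε / 2 :=
    (TopologicalSpace.denseRange_denseSeq E).exists_dist_lt p (half_pos hε)
  let c₀ (p : E) : ℕ := Nat.find (hex p)
  have hc₀ : Measurable c₀ := measurable_find hex fun k =>
    (Metric.isOpen_ball (x := TopologicalSpace.denseSeq E k) (ε := ε / 2)).measurableSet
  let bit (S : Set E) (p : E) : ℕ := if p ∈ S then 1 else 0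
  have hbit {S : Set E} (hS : MeasurableSet S) : Measurable (bit S) :=
    Measurable.ite hS measurable_const measurable_const
  refine ⟨fun p => Nat.pair (c₀ p) (Nat.pair (bit B p) (bit W p)), ?_, fun p p' h => ?_⟩
  · exact (measurable_of_countable fun q : ℕ × ℕ × ℕ => Nat.pair q.1 (Nat.pair q.2.1 q.2.2)).comp
      (hc₀.prodMk ((hbit hB).prodMk (hbit hW)))
  · simp only [Nat.pair_eq_pair] at h
    obtain ⟨h1, h2, h3⟩ := h
    have hS {S : Set E} (h : bit S p = bit S p') : p ∈ S ↔ p' ∈ S := by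
      dsimp only [bit] at h
      split_ifs at h <;> simp_all
    refine ⟨?_, hS h2, hS h3⟩
    have h4 : dist p (TopologicalSpace.denseSeq E (c₀ p)) < ε / 2 := Nat.find_spec (hex p)
    have h5 : dist p' (TopologicalSpace.denseSeq E (c₀ p')) < ε / 2 := Nat.find_spec (hex p')
    rw [← h1] at h5
    linarith [dist_triangle_right p p' (TopologicalSpace.denseSeq E (c₀ p))]

namespace IsPoissonProcess

variable {Ω : Type*} [MeasurableSpace Ω] {P : Measure Ω} {X : ℕ → Ω → Plane} {lam : ℝ≥0}

lemma lintegral_pointCount (hX : IsPoissonProcess P X lam) {B : Set Plane}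
    (hB : MeasurableSet B) : ∫⁻ ω, pointCount X B ω ∂P = lam * volume B := by
  obtain ⟨c, hc, hcell⟩ := exists_measurable_cells one_pos hB hB
  have hcb (b : ℕ) : Bornology.IsBounded (c ⁻¹' {b}) := by
    rw [Metric.isBounded_iff]
    exact ⟨1, fun p hp p' hp' => (hcell p p' (hp.trans hp'.symm)).1.le⟩
  have hA : c ⁻¹' (c '' B) = B := by
    refine Set.Subset.antisymm ?_ (Set.subset_preimage_image c B)
    rintro p ⟨p', hp', h⟩
    exact (hcell p' p h).2.1.1 hp'
  have h := hX.lintegral_tsum_cells hc hcb (fun _ _ => 0) (c '' B)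
  rw [hA] at h
  simpa [pointCount] using h

/-- The Mecke identity survives limits: since `expNeg ≤ 1`, the point count of `B`, of finite mean,
dominates on the left and the constant `1` on `B` on the right. -/
lemma lintegral_tsum_of_tendsto (hX : IsPoissonProcess P X lam) {B : Set Plane}
    (hB : MeasurableSet B) (hB' : volume B ≠ ∞) {g : ℕ → Plane → Plane → ℝ≥0∞}
    {g' : Plane → Plane → ℝ≥0∞} (hg : ∀ n, Measurable (Function.uncurry (g n)))
    (hmecke : ∀ n, ∫⁻ ω, ∑' i, B.indicator 1 (X i ω) *
        expNeg (∑' j, if j = i then 0 else g n (X i ω) (X j ω)) ∂P =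
      lam * ∫⁻ x in B, expNeg (lam * ∫⁻ p, (1 - expNeg (g n x p))))
    (hsum : ∀ᵐ ω ∂P, ∀ i, Tendsto (fun n => ∑' j, if j = i then 0 else g n (X i ω) (X j ω)) atTop
      (𝓝 (∑' j, if j = i then 0 else g' (X i ω) (X j ω))))
    (hint : ∀ x, Tendsto (fun n => ∫⁻ p, (1 - expNeg (g n x p))) atTop
      (𝓝 (∫⁻ p, (1 - expNeg (g' x p))))) :
    ∫⁻ ω, ∑' i, B.indicator 1 (X i ω) *
        expNeg (∑' j, if j = i then 0 else g' (X i ω) (X j ω)) ∂P =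
      lam * ∫⁻ x in B, expNeg (lam * ∫⁻ p, (1 - expNeg (g' x p))) := by
  have hgm (n i j : ℕ) : Measurable fun ω => g n (X i ω) (X j ω) :=
    (hg n).comp ((hX.measurable i).prodMk (hX.measurable j))
  have h1 := tendsto_lintegral_tsum_of_le (P := P)
    (f := fun n i ω => B.indicator 1 (X i ω) *
      expNeg (∑' j, if j = i then 0 else g n (X i ω) (X j ω)))
    (g := fun i ω => B.indicator 1 (X i ω) *
      expNeg (∑' j, if j = i then 0 else g' (X i ω) (X j ω)))
    (b := fun i ω => B.indicator 1 (X i ω))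
    (fun n i ω => mul_le_of_le_one_right' (expNeg_le_one _))
    (fun n i => (hX.measurable_indicator hB i).mul
      (measurable_expNeg.comp (measurable_ite_tsum i (hgm n i))))
    (hX.measurable_indicator hB)
    (by
      have := hX.lintegral_pointCount hB
      unfold pointCount at this
      rw [this]
      exact ENNReal.mul_ne_top ENNReal.coe_ne_top hB')
    (by
      filter_upwards [hsum] with ω hω i
      refine ENNReal.Tendsto.const_mul ((continuous_expNeg.tendsto _).comp (hω i)) (Or.inr ?_)
      by_cases hi : X i ω ∈ B <;> simp [hi])
  have h2 : Tendsto (fun n => lam * ∫⁻ x in B, expNeg (lam * ∫⁻ p, (1 - expNeg (g n x p)))) atTop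
      (𝓝 (lam * ∫⁻ x in B, expNeg (lam * ∫⁻ p, (1 - expNeg (g' x p))))) := by
    refine ENNReal.Tendsto.const_mul ?_ (Or.inr ENNReal.coe_ne_top)
    refine tendsto_lintegral_of_dominated_convergence (fun _ => 1) (fun n => ?_)
      (fun n => Eventually.of_forall fun x => expNeg_le_one _) (by simpa using hB')
      (Eventually.of_forall fun x => (continuous_expNeg.tendsto _).comp
        (ENNReal.Tendsto.const_mul (hint x) (Or.inr ENNReal.coe_ne_top)))
    refine measurable_expNeg.comp (Measurable.const_mul ?_ _)
    exact Measurable.lintegral_prod_right' (f := fun q : Plane × Plane => 1 - expNeg (g n q.1 q.2))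
      (measurable_const.sub (measurable_expNeg.comp (hg n)))
  refine tendsto_nhds_unique h1 (h2.congr fun n => (hmecke n).symm)

/-- Approximation by functions of cells. They need not be monotone in `n`, so the bounded window `W`
is what lets limits pass through the sum (finitely many points) and the integral (domination by the
indicator of `W`). -/
lemma lintegral_tsum_indicator_upperSemicontinuous (hX : IsPoissonProcess P X lam)
    {B W : Set Plane} (hB : MeasurableSet B) (hB' : volume B ≠ ∞) (hW : MeasurableSet W)
    (hW' : Bornology.IsBounded W) {h : Plane → ℝ≥0∞} (hh : UpperSemicontinuous h) :
    ∫⁻ ω, ∑' i, B.indicator 1 (X i ω) *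
        expNeg (∑' j, if j = i then 0 else W.indicator (fun p => h (p - X i ω)) (X j ω)) ∂P =
      lam * ∫⁻ x in B, expNeg (lam * ∫⁻ p, (1 - expNeg (W.indicator (fun p => h (p - x)) p))) := by
  choose c hc hcell using fun n : ℕ =>
    exists_measurable_cells (E := Plane) (Nat.one_div_pos_of_nat (α := ℝ) (n := n)) hB hW
  have hcb (n b : ℕ) : Bornology.IsBounded (c n ⁻¹' {b}) := by
    rw [Metric.isBounded_iff]
    exact ⟨_, fun p hp p' hp' => (hcell n p p' (hp.trans hp'.symm)).1.le⟩
  have hA (n : ℕ) : c n ⁻¹' (c n '' B) = B := by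
    refine Set.Subset.antisymm ?_ (Set.subset_preimage_image _ B)
    rintro p ⟨p', hp', h⟩
    exact (hcell n p' p h).2.1.1 hp'
  -- The least majorant depending only on the two cells; upper semicontinuity of `h` makes it
  -- converge to the function at each pair.
  let G (n a b : ℕ) : ℝ≥0∞ := ⨆ (x : Plane) (_ : c n x = a) (p : Plane) (_ : c n p = b),
    W.indicator (fun p => h (p - x)) p
  have hG_notMem (n : ℕ) (x p : Plane) (hp : p ∉ W) : G n (c n x) (c n p) = 0 := by
    simp only [G, ENNReal.iSup_eq_zero]
    intro x' _ p' hp'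
    exact Set.indicator_of_notMem (fun hp'' => hp ((hcell n p' p hp').2.2.1 hp'')) _
  have hG_lim (x p : Plane) : Tendsto (fun n => G n (c n x) (c n p)) atTop
      (𝓝 (W.indicator (fun p => h (p - x)) p)) := by
    by_cases hp : p ∈ W
    swap
    · simp [hG_notMem, hp]
    rw [Set.indicator_of_mem hp]
    refine tendsto_order.2 ⟨fun a ha => Eventually.of_forall fun n => ha.trans_le ?_,
      fun b hb => ?_⟩
    · refine le_iSup₂_of_le x rfl (le_iSup₂_of_le p rfl ?_)
      rw [Set.indicator_of_mem hp]
    · obtain ⟨b', hb1, hb2⟩ := exists_between hb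
      obtain ⟨δ, hδ, hball⟩ := Metric.eventually_nhds_iff.1 (hh (p - x) b' hb1)
      have h0 : Tendsto (fun n : ℕ => 1 / ((n : ℝ) + 1)) atTop (𝓝 0) :=
        tendsto_one_div_add_atTop_nhds_zero_nat
      filter_upwards [h0.eventually (gt_mem_nhds (half_pos hδ))] with n hn
      refine lt_of_le_of_lt (iSup₂_le fun x' hx' => iSup₂_le fun p' hp' => ?_) hb2
      refine (Set.indicator_le_self _ _ _).trans (hball ?_).le
      have h1 := (hcell n x' x hx').1
      have h2 := (hcell n p' p hp').1
      calc dist (p' - x') (p - x) ≤ dist p' p + dist x' x := dist_sub_sub_le _ _ _ _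
        _ < δ := by linarith
  refine hX.lintegral_tsum_of_tendsto hB hB' (g := fun n x p => G n (c n x) (c n p))
    (g' := fun x p => W.indicator (fun p => h (p - x)) p) (fun n => ?_) (fun n => ?_) ?_
    (fun x => ?_)
  · exact (measurable_of_countable fun q : ℕ × ℕ => G n q.1 q.2).comp
      (((hc n).comp measurable_fst).prodMk ((hc n).comp measurable_snd))
  · have := hX.lintegral_tsum_cells (hc n) (hcb n) (G n) (c n '' B)
    rwa [hA] at this
  · filter_upwards [hX.ae_pointCount_lt_top hW hW'] with ω hω i
    have hfin : {j | X j ω ∈ W}.Finite := by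
      refine (ENNReal.finite_const_le_of_tsum_ne_top hω.ne one_ne_zero).subset fun j hj => ?_
      simp [Set.indicator_of_mem (show X j ω ∈ W from hj)]
    have hrw (n : ℕ) : (∑' j, if j = i then 0 else G n (c n (X i ω)) (c n (X j ω))) =
        ∑ j ∈ hfin.toFinset, if j = i then 0 else G n (c n (X i ω)) (c n (X j ω)) := by
      refine tsum_eq_sum fun j hj => ?_
      rw [hG_notMem _ _ _ (by simpa using hj), ite_self]
    have hrw' : (∑' j, if j = i then 0 else W.indicator (fun p => h (p - X i ω)) (X j ω)) =
        ∑ j ∈ hfin.toFinset, if j = i then 0 else W.indicator (fun p => h (p - X i ω)) (X j ω) := by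
      refine tsum_eq_sum fun j hj => ?_
      rw [Set.indicator_of_notMem (by simpa using hj), ite_self]
    simp_rw [hrw, hrw']
    refine tendsto_finsetSum _ fun j _ => ?_
    split_ifs
    · exact tendsto_const_nhds
    · exact hG_lim _ _
  · refine tendsto_lintegral_of_dominated_convergence (W.indicator 1) (fun n => ?_)
      (fun n => Eventually.of_forall fun p => ?_) ?_ (Eventually.of_forall fun p => ?_)
    · exact (measurable_of_countable fun b => 1 - expNeg (G n (c n x) b)).comp (hc n)
    · by_cases hp : p ∈ W
      · simp [hp]
      · simp [hp, hG_notMem]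
    · rw [lintegral_indicator_one hW]
      exact hW'.measure_lt_top.ne
    · exact ((ENNReal.continuous_sub_left ENNReal.one_ne_top).tendsto _).comp
        ((continuous_expNeg.tendsto _).comp (hG_lim x p))

/-- The Mecke formula for the functional `exp (-∑ h)` of the other points, as seen from a point of
the process. -/
theorem lintegral_tsum_expNeg (hX : IsPoissonProcess P X lam)
    {B : Set Plane} (hB : MeasurableSet B) (hB' : volume B ≠ ∞) {h : Plane → ℝ≥0∞}
    (hh : UpperSemicontinuous h) :
    ∫⁻ ω, ∑' i, B.indicator 1 (X i ω) *
        expNeg (∑' j, if j = i then 0 else h (X j ω - X i ω)) ∂P =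
      lam * volume B * expNeg (lam * ∫⁻ p, (1 - expNeg (h p))) := by
  have hhm : Measurable h := hh.measurable
  -- The windows exhaust the plane and the truncated functions increase, so monotone convergence
  -- removes the window without any integrability of `h`.
  let W (n : ℕ) : Set Plane := Metric.closedBall 0 n
  have hW (n : ℕ) : MeasurableSet (W n) := Metric.isClosed_closedBall.measurableSet
  have hmono (x p : Plane) : Monotone fun n => (W n).indicator (fun p => h (p - x)) p := by
    intro n m hnm
    exact Set.indicator_le_indicator_of_subset
      (Metric.closedBall_subset_closedBall (by exact_mod_cast hnm)) (fun _ => zero_le) p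
  have hlim (x p : Plane) : Tendsto (fun n => (W n).indicator (fun p => h (p - x)) p) atTop
      (𝓝 (h (p - x))) := by
    refine tendsto_const_nhds.congr' ?_
    obtain ⟨N, hN⟩ := exists_nat_ge (dist p 0)
    filter_upwards [eventually_ge_atTop N] with n hn
    rw [Set.indicator_of_mem]
    exact hN.trans (by exact_mod_cast hn)
  have key := hX.lintegral_tsum_of_tendsto hB hB'
    (g := fun n x p => (W n).indicator (fun p => h (p - x)) p) (g' := fun x p => h (p - x))
    (fun n => ?_) (fun n => hX.lintegral_tsum_indicator_upperSemicontinuous hB hB' (hW n)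
      Metric.isBounded_closedBall hh) (Eventually.of_forall fun ω i => ?_) (fun x => ?_)
  · rw [key]
    have htrans (x : Plane) : ∫⁻ p, (1 - expNeg (h (p - x))) = ∫⁻ p, (1 - expNeg (h p)) :=
      lintegral_sub_right_eq_self (fun p => 1 - expNeg (h p)) x
    simp_rw [htrans]
    rw [lintegral_const, Measure.restrict_apply_univ]
    ring
  · have : Function.uncurry (fun x p => (W n).indicator (fun p => h (p - x)) p) =
        (Prod.snd ⁻¹' W n).indicator fun q : Plane × Plane => h (q.2 - q.1) := by
      ext q
      rfl
    rw [this]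
    exact (hhm.comp (measurable_snd.sub measurable_fst)).indicator (measurable_snd (hW n))
  · refine ENNReal.tendsto_tsum_of_monotone (fun j => ?_) fun j => ?_
    · by_cases hj : j = i
      · simpa [hj] using monotone_const
      · simpa [hj] using hmono _ _
    · by_cases hj : j = i
      · simp [hj]
      · simpa [hj] using hlim _ _
  · refine lintegral_tendsto_of_tendsto_of_monotone (fun n => ?_)
      (Eventually.of_forall fun p n m hnm => ?_) (Eventually.of_forall fun p => ?_)
    · exact (measurable_const.sub (measurable_expNeg.comp
        ((hhm.comp (measurable_id.sub_const x)).indicator (hW n)))).aemeasurable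
    · exact tsub_le_tsub_left (expNeg_antitone (hmono x p hnm)) 1
    · exact ((ENNReal.continuous_sub_left ENNReal.one_ne_top).tendsto _).comp
        ((continuous_expNeg.tendsto _).comp (hlim x p))

end IsPoissonProcess

/-! ### Geometry of segments and random closed sets -/

lemma mem_segment_sub_iff {E : Type*} [AddCommGroup E] [Module ℝ E] {y z p s : E} :
    s ∈ segment ℝ (y - p) (z - p) ↔ s + p ∈ segment ℝ y z := by
  rw [← mem_segment_translate ℝ p, add_sub_cancel, add_sub_cancel, add_comm]

lemma setOf_segment_sub_inter_nonempty {E : Type*} [AddCommGroup E] [Module ℝ E] (y z : E)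
    (A : Set E) : {p | (segment ℝ (y - p) (z - p) ∩ A).Nonempty} = segment ℝ y z + -A := by
  ext p
  simp only [Set.mem_ofPred_eq, Set.mem_add, Set.mem_neg]
  constructor
  · rintro ⟨s, hs, hsA⟩
    exact ⟨s + p, mem_segment_sub_iff.1 hs, -s, by simpa using hsA, by abel⟩
  · rintro ⟨s, hs, a, ha, rfl⟩
    exact ⟨-a, mem_segment_sub_iff.2 (by simpa using hs), ha⟩

lemma exists_mem_segment_dist_le {E : Type*} [NormedAddCommGroup E] [NormedSpace ℝ E]
    {y z y' z' s : E} {ε : ℝ} (hy : dist y y' ≤ ε) (hz : dist z z' ≤ ε)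
    (hs : s ∈ segment ℝ y z) : ∃ s' ∈ segment ℝ y' z', dist s s' ≤ ε := by
  obtain ⟨a, b, ha, hb, hab, rfl⟩ := hs
  refine ⟨a • y' + b • z', ⟨a, b, ha, hb, hab, rfl⟩, ?_⟩
  calc dist (a • y + b • z) (a • y' + b • z') ≤ dist (a • y) (a • y') + dist (b • z) (b • z') :=
        dist_add_add_le _ _ _ _
    _ = a * dist y y' + b * dist z z' := by
        rw [dist_smul₀, dist_smul₀, Real.norm_of_nonneg ha, Real.norm_of_nonneg hb]
    _ ≤ a * ε + b * ε := by gcongr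
    _ = ε := by rw [← add_mul, hab, one_mul]

lemma isCompact_segment {E : Type*} [NormedAddCommGroup E] [NormedSpace ℝ E] (y z : E) :
    IsCompact (segment ℝ y z) := by
  rw [segment_eq_image_lineMap]
  exact isCompact_Icc.image (AffineMap.lineMap_continuous)

/-- Replaces the existential over `(r, θ)` by a condition that is visibly measurable. As `arg` lies
in `(-π, π]`, angles above `π` are `arg + 2π`; both cases include `arg = 0` because `θ = 0` and `θ =
2π` are both admitted. -/
lemma mem_radialSet_iff {R : ℝ → ℝ≥0} {p : Plane} :
    p ∈ radialSet R ↔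
      (0 ≤ (Complex.mk (p 0) (p 1)).arg ∧ ‖p‖ ≤ R (Complex.mk (p 0) (p 1)).arg) ∨
      ((Complex.mk (p 0) (p 1)).arg ≤ 0 ∧
        ‖p‖ ≤ R ((Complex.mk (p 0) (p 1)).arg + 2 * Real.pi)) := by
  have hnorm : ‖p‖ = ‖Complex.mk (p 0) (p 1)‖ := by
    rw [EuclideanSpace.norm_eq, Complex.norm_eq_sqrt_sq_add_sq]
    simp
  constructor
  · rintro ⟨r, θ, ⟨hr0, hrR⟩, ⟨hθ0, hθ1⟩, rfl⟩
    have h1 : Complex.mk ((!₂[r * Real.cos θ, r * Real.sin θ] : Plane) 0)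
        ((!₂[r * Real.cos θ, r * Real.sin θ] : Plane) 1) =
        r * (Complex.cos θ + Complex.sin θ * Complex.I) := by
      apply Complex.ext <;> simp [← Complex.ofReal_cos, ← Complex.ofReal_sin]
    rw [hnorm, h1]
    have h2 : ‖(r : ℂ) * (Complex.cos θ + Complex.sin θ * Complex.I)‖ = r := by
      rw [norm_mul, Complex.norm_cos_add_sin_mul_I, Complex.norm_real, Real.norm_of_nonneg hr0,
        mul_one]
    rw [h2]
    -- At the origin the angle is arbitrary, but `arg 0 = 0` and norm `0` satisfy the condition for
    -- every range.
    rcases hr0.eq_or_lt with rfl | hr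
    · simp
    rcases le_or_gt θ Real.pi with hθ | hθ
    · rw [Complex.arg_mul_cos_add_sin_mul_I hr ⟨by linarith [Real.pi_pos], hθ⟩]
      exact Or.inl ⟨hθ0, hrR⟩
    · have h3 : Complex.cos θ + Complex.sin θ * Complex.I =
          Complex.cos ((θ - 2 * Real.pi : ℝ) : ℂ) +
            Complex.sin ((θ - 2 * Real.pi : ℝ) : ℂ) * Complex.I := by
        push_cast
        rw [Complex.cos_sub_two_pi, Complex.sin_sub_two_pi]
      rw [h3, Complex.arg_mul_cos_add_sin_mul_I hr ⟨by linarith, by linarith [Real.pi_pos]⟩]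
      exact Or.inr ⟨by linarith, by simpa using hrR⟩
  · have h0 : p 0 = ‖p‖ * Real.cos (Complex.mk (p 0) (p 1)).arg := by
      rw [hnorm, Complex.norm_mul_cos_arg]
    have h1 : p 1 = ‖p‖ * Real.sin (Complex.mk (p 0) (p 1)).arg := by
      rw [hnorm, Complex.norm_mul_sin_arg]
    have h2 := Complex.neg_pi_lt_arg (Complex.mk (p 0) (p 1))
    have h3 := Complex.arg_le_pi (Complex.mk (p 0) (p 1))
    rintro (⟨ha, hR⟩ | ⟨ha, hR⟩)
    · refine ⟨‖p‖, _, ⟨norm_nonneg p, hR⟩, ⟨ha, by linarith [Real.pi_pos]⟩, ?_⟩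
      ext k
      fin_cases k
      · simpa using h0
      · simpa using h1
    · refine ⟨‖p‖, _, ⟨norm_nonneg p, hR⟩, ⟨by linarith [Real.pi_pos], by linarith⟩, ?_⟩
      ext k
      fin_cases k
      · simpa using h0
      · simpa using h1

/-- The points visible from `y` in the complement of `E` up to the last point of the line of sight
differ from those with a completely free line of sight by a null set. -/
lemma volume_visible_diff_clear (y : Plane) (E : Set Plane)
    (hE : MeasurableSet {z | segment ℝ y z ∩ E = ∅}) :
    volume ({z | segment ℝ y z ∩ E ⊆ {z}} \ {z | segment ℝ y z ∩ E = ∅}) = 0 := by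
  set U := {z | segment ℝ y z ∩ E = ∅} with hU
  set V := {z | segment ℝ y z ∩ E ⊆ {z}} with hV
  have hUV : U ⊆ V := fun z hz => by simp only [hV, Set.mem_ofPred_eq]; rw [hz]; simp
  -- An obstacle point on the shortened segment also lies on the segment to `z`, hence equals `z`;
  -- but its parameter is at most `t < 1`.
  have hscale {t : ℝ} (ht0 : 0 < t) (ht1 : t < 1) {z : Plane} (hz : z ∈ V) (hzy : z ≠ y) :
      AffineMap.homothety y t z ∈ U := by
    refine Set.eq_empty_of_forall_notMem fun w ⟨hw, hwE⟩ => ?_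
    have hw' : ∃ s ∈ Set.Icc (0 : ℝ) t, w = AffineMap.lineMap y z s := by
      rw [segment_eq_image_lineMap] at hw
      obtain ⟨s, hs, rfl⟩ := hw
      refine ⟨s * t, ⟨mul_nonneg hs.1 ht0.le, mul_le_of_le_one_left ht0.le hs.2⟩, ?_⟩
      rw [AffineMap.homothety_eq_lineMap]
      simp [AffineMap.lineMap_apply, smul_smul]
    obtain ⟨s, hs, rfl⟩ := hw'
    have h1 : AffineMap.lineMap y z s ∈ segment ℝ y z := by
      rw [segment_eq_image_lineMap]
      exact ⟨s, ⟨hs.1, hs.2.trans ht1.le⟩, rfl⟩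
    have h2 : AffineMap.lineMap y z s = z := hz ⟨h1, hwE⟩
    rw [AffineMap.lineMap_eq_right_iff] at h2
    rcases h2 with h2 | h2
    · exact hzy h2.symm
    · linarith [hs.2]
  have hball (n : ℕ) : volume ((V \ U) ∩ Metric.ball y n) = 0 := by
    -- The homothety of ratio `t` multiplies area by `t ^ 2` and keeps the ball. Balls are used so
    -- that the measures are finite and can be subtracted.
    have hle (t : ℝ) (ht0 : 0 < t) (ht1 : t < 1) :
        ENNReal.ofReal (t ^ 2) * volume ((V \ {y}) ∩ Metric.ball y n) ≤
          volume (U ∩ Metric.ball y n) := by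
      have h1 := Measure.addHaar_image_homothety (volume : Measure Plane) y t
        ((V \ {y}) ∩ Metric.ball y n)
      rw [finrank_euclideanSpace_fin, abs_of_nonneg (by positivity)] at h1
      rw [← h1]
      refine measure_mono ?_
      rintro _ ⟨z, ⟨⟨hzV, hzy⟩, hzn⟩, rfl⟩
      refine ⟨hscale ht0 ht1 hzV hzy, ?_⟩
      rw [Metric.mem_ball] at hzn ⊢
      rw [dist_homothety_center, Real.norm_of_nonneg ht0.le]
      have := dist_nonneg (x := y) (y := z)
      rw [dist_comm] at hzn
      nlinarith
    have hfin : volume (U ∩ Metric.ball y n) ≠ ∞ :=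
      (measure_mono Set.inter_subset_right).trans_lt Metric.isBounded_ball.measure_lt_top |>.ne
    have hfin' : volume ((V \ {y}) ∩ Metric.ball y n) ≠ ∞ :=
      (measure_mono Set.inter_subset_right).trans_lt Metric.isBounded_ball.measure_lt_top |>.ne
    have hle1 : volume ((V \ {y}) ∩ Metric.ball y n) ≤ volume (U ∩ Metric.ball y n) := by
      have hlim : Tendsto (fun t : ℝ => ENNReal.ofReal (t ^ 2) *
          volume ((V \ {y}) ∩ Metric.ball y n)) (𝓝[<] 1)
          (𝓝 (ENNReal.ofReal (1 ^ 2) * volume ((V \ {y}) ∩ Metric.ball y n))) := by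
        refine ENNReal.Tendsto.mul_const ?_ (Or.inr hfin')
        have : Continuous fun t : ℝ => ENNReal.ofReal (t ^ 2) :=
          ENNReal.continuous_ofReal.comp (continuous_pow 2)
        exact (this.tendsto 1).mono_left nhdsWithin_le_nhds
      simp only [one_pow, ENNReal.ofReal_one, one_mul] at hlim
      refine le_of_tendsto hlim ?_
      filter_upwards [Ioo_mem_nhdsLT (zero_lt_one' ℝ)] with t ht
      exact hle t ht.1 ht.2
    have hle2 : volume (V ∩ Metric.ball y n) ≤ volume (U ∩ Metric.ball y n) := by
      refine le_trans ?_ hle1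
      calc volume (V ∩ Metric.ball y n)
          ≤ volume (((V \ {y}) ∩ Metric.ball y n) ∪ {y}) := measure_mono (by
            rintro z ⟨hz, hz'⟩
            by_cases hzy : z = y
            · exact Or.inr hzy
            · exact Or.inl ⟨⟨hz, hzy⟩, hz'⟩)
        _ ≤ _ := (measure_union_le _ _).trans (by simp)
    have h3 : (V \ U) ∩ Metric.ball y n = (V ∩ Metric.ball y n) \ (U ∩ Metric.ball y n) := by
      ext z
      simp only [Set.mem_inter_iff, Set.mem_sdiff]
      tauto
    rw [h3, measure_sdiff (Set.inter_subset_inter_left _ hUV)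
      (hE.inter measurableSet_ball).nullMeasurableSet hfin]
    exact tsub_eq_zero_of_le hle2
  have : V \ U = ⋃ n : ℕ, (V \ U) ∩ Metric.ball y n := by
    rw [← Set.inter_iUnion, Metric.iUnion_ball_nat, Set.inter_univ]
  rw [this]
  exact measure_iUnion_null hball

/-! ### Measurability of the objects and the probability of missing a segment -/

namespace ObjectModel

variable {𝕄 : Type*} [MeasurableSpace 𝕄] (D : ObjectModel 𝕄)

/-- Only hits of fixed compact sets are known to be measurable. The moving segment is therefore
approximated by thickened segments with endpoints in a countable dense set; a closed shape disjoint
from a compact segment stays at positive distance, so the approximation is exact in the limit. -/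
lemma measurableSet_segment_inter_shape :
    MeasurableSet {q : 𝕄 × Plane × Plane |
      (segment ℝ q.2.1 q.2.2 ∩ D.shape q.1).Nonempty} := by
  let d := TopologicalSpace.denseSeq Plane
  let ε (n : ℕ) : ℝ := 1 / ((n : ℝ) + 1)
  have hε (n : ℕ) : 0 < ε n := Nat.one_div_pos_of_nat
  have heq : {q : 𝕄 × Plane × Plane | (segment ℝ q.2.1 q.2.2 ∩ D.shape q.1).Nonempty} =
      ⋂ n, ⋃ k, ⋃ l, {m | (D.shape m ∩
        Metric.cthickening (ε n) (segment ℝ (d k) (d l))).Nonempty} ×ˢ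
          (Metric.ball (d k) (ε n) ×ˢ Metric.ball (d l) (ε n)) := by
    ext ⟨m, y, z⟩
    simp only [Set.mem_ofPred_eq, Set.mem_iInter, Set.mem_iUnion, Set.mem_prod, Metric.mem_ball]
    constructor
    · rintro ⟨s, hs, hsA⟩ n
      obtain ⟨k, hk⟩ := (TopologicalSpace.denseRange_denseSeq Plane).exists_dist_lt y (hε n)
      obtain ⟨l, hl⟩ := (TopologicalSpace.denseRange_denseSeq Plane).exists_dist_lt z (hε n)
      obtain ⟨s', hs', hss'⟩ := exists_mem_segment_dist_le hk.le hl.le hs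
      exact ⟨k, l, ⟨s, hsA, Metric.mem_cthickening_of_dist_le s s' _ _ hs' hss'⟩, hk, hl⟩
    · intro h
      by_contra hne
      have hdisj : Disjoint (segment ℝ y z) (D.shape m) :=
        Set.disjoint_iff_inter_eq_empty.2 (Set.not_nonempty_iff_eq_empty.1 hne)
      obtain ⟨δ, hδ, hdisj'⟩ := hdisj.exists_thickenings (isCompact_segment y z)
        (D.isClosed_shape m)
      -- Half of `δ`, since two errors of size `ε n` add up: the thickening and the displaced
      -- endpoints.
      obtain ⟨n, hn⟩ := exists_nat_one_div_lt (half_pos hδ)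
      obtain ⟨k, l, ⟨a, haA, ha⟩, hk, hl⟩ := h n
      rw [(isCompact_segment _ _).cthickening_eq_biUnion_closedBall (hε n).le] at ha
      simp only [Set.mem_iUnion, Metric.mem_closedBall, exists_prop] at ha
      obtain ⟨s', hs', has'⟩ := ha
      rw [dist_comm] at hk hl
      obtain ⟨s, hs, hss'⟩ := exists_mem_segment_dist_le hk.le hl.le hs'
      refine Set.disjoint_left.1 hdisj' (?_ : a ∈ _) ?_
      · refine Metric.mem_thickening_iff.2 ⟨s, hs, ?_⟩
        have : ε n < δ / 2 := hn
        linarith [dist_triangle a s' s]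
      · exact Metric.self_subset_thickening hδ _ haA
  rw [heq]
  refine MeasurableSet.iInter fun n => MeasurableSet.iUnion fun k => MeasurableSet.iUnion fun l =>
    MeasurableSet.prod (D.measurableSet_hit _ ?_) (measurableSet_ball.prod measurableSet_ball)
  exact (isCompact_segment _ _).cthickening

lemma measurableSet_mem_shape : MeasurableSet {q : 𝕄 × Plane | q.2 ∈ D.shape q.1} := by
  have h : Measurable fun q : 𝕄 × Plane => (q.1, q.2, q.2) := by fun_prop
  convert! h D.measurableSet_segment_inter_shape using 1
  ext q
  simp

lemma measurableSet_mem_support :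
    MeasurableSet {q : 𝕄 × Plane | q.2 ∈ {D.offset q.1} + D.support q.1} := by
  have h : {q : 𝕄 × Plane | q.2 ∈ {D.offset q.1} + D.support q.1} =
      {q | q.1 ∈ D.sensors ∧ q.2 - D.offset q.1 ∈ radialSet (D.range q.1)} := by
    ext q
    by_cases hq : q.1 ∈ D.sensors
    · simp [support, hq, sub_eq_add_neg, add_comm]
    · simp [support, hq]
  rw [h]
  simp_rw [mem_radialSet_iff]
  have h1 : Measurable fun q : 𝕄 × Plane => q.2 - D.offset q.1 :=
    measurable_snd.sub (D.measurable_offset.comp measurable_fst)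
  have h2 : Measurable fun q : 𝕄 × Plane =>
      (Complex.mk ((q.2 - D.offset q.1) 0) ((q.2 - D.offset q.1) 1)).arg := by
    refine Complex.measurable_arg.comp ?_
    have h3 (k : Fin 2) : Measurable fun q : 𝕄 × Plane => (q.2 - D.offset q.1) k :=
      (EuclideanSpace.proj (𝕜 := ℝ) k).continuous.measurable.comp h1
    have h4 : Continuous fun w : ℝ × ℝ => Complex.mk w.1 w.2 :=
      Complex.equivRealProdCLM.symm.continuous
    exact h4.measurable.comp ((h3 0).prodMk (h3 1))
  have h5 {g : 𝕄 × Plane → ℝ} (hg : Measurable g) :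
      Measurable fun q : 𝕄 × Plane => ((D.range q.1 (g q) : ℝ≥0) : ℝ) :=
    measurable_coe_nnreal_real.comp (D.measurable_range.comp (measurable_fst.prodMk hg))
  refine (measurable_fst D.measurableSet_sensors).inter (MeasurableSet.union ?_ ?_)
  · exact (measurableSet_le measurable_const h2).inter (measurableSet_le h1.norm (h5 h2))
  · exact (measurableSet_le h2 measurable_const).inter
      (measurableSet_le h1.norm (h5 (h2.add_const _)))

/-- The probability that an object with centre `p` and a mark of law `F` does not meet the segment
from `y` to `z`. -/
noncomputable def missProb (F : Measure 𝕄) (y z p : Plane) : ℝ≥0∞ :=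
  F {a | ¬ (segment ℝ (y - p) (z - p) ∩ D.shape a).Nonempty}

variable (F : Measure 𝕄)

/-- A closed shape that misses a compact segment also misses its small translates. So the event of a
miss at `p` is the increasing union of the events of a miss throughout a ball about `p`. -/
lemma lowerSemicontinuous_missProb (y z : Plane) : LowerSemicontinuous (D.missProb F y z) := by
  intro p t ht
  let S (n : ℕ) : Set 𝕄 := {a | ∀ p' ∈ Metric.ball p (1 / ((n : ℝ) + 1)),
    ¬ (segment ℝ (y - p') (z - p') ∩ D.shape a).Nonempty}
  have hS : Monotone S := fun n m hnm a ha p' hp' =>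
    ha p' (Metric.ball_subset_ball (Nat.one_div_le_one_div hnm) hp')
  have hS' : {a | ¬ (segment ℝ (y - p) (z - p) ∩ D.shape a).Nonempty} = ⋃ n, S n := by
    ext a
    simp only [Set.mem_iUnion, Set.mem_ofPred_eq]
    constructor
    · intro ha
      have hdisj : Disjoint (segment ℝ (y - p) (z - p)) (D.shape a) :=
        Set.disjoint_iff_inter_eq_empty.2 (Set.not_nonempty_iff_eq_empty.1 ha)
      obtain ⟨δ, hδ, hdisj'⟩ := hdisj.exists_thickenings (isCompact_segment _ _)
        (D.isClosed_shape a)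
      obtain ⟨n, hn⟩ := exists_nat_one_div_lt hδ
      refine ⟨n, fun p' hp' ⟨s, hs, hsA⟩ => ?_⟩
      have hd (w : Plane) : dist (w - p') (w - p) ≤ dist p' p := by
        rw [dist_sub_left]
      obtain ⟨s', hs', hss'⟩ := exists_mem_segment_dist_le (hd y) (hd z) hs
      exact Set.disjoint_left.1 hdisj' (Metric.mem_thickening_iff.2
        ⟨s', hs', (hss'.trans_lt hp').trans hn⟩) (Metric.self_subset_thickening hδ _ hsA)
    · rintro ⟨n, hn⟩
      exact hn p (Metric.mem_ball_self Nat.one_div_pos_of_nat)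
  -- Continuity from below holds for increasing unions of arbitrary sets, so `S n` need not be
  -- measurable.
  rw [missProb, hS', hS.measure_iUnion, gt_iff_lt, lt_iSup_iff] at ht
  obtain ⟨n, hn⟩ := ht
  filter_upwards [Metric.ball_mem_nhds p (Nat.one_div_pos_of_nat (α := ℝ) (n := n))] with p' hp'
  exact hn.trans_le (measure_mono fun a ha => ha p' hp')

variable [IsProbabilityMeasure F]

lemma missProb_le_one (y z p : Plane) : D.missProb F y z p ≤ 1 := prob_le_one

lemma upperSemicontinuous_negLog_missProb (y z : Plane) :
    UpperSemicontinuous fun p => negLog (D.missProb F y z p) := by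
  intro p c hc
  rw [negLog_lt (D.missProb_le_one F y z p)] at hc
  filter_upwards [D.lowerSemicontinuous_missProb F y z p _ hc] with p' hp'
  rwa [negLog_lt (D.missProb_le_one F y z p')]

lemma measurable_missProb :
    Measurable fun q : Plane × Plane × Plane => D.missProb F q.1 q.2.1 q.2.2 := by
  have h : Measurable fun q : (Plane × Plane × Plane) × 𝕄 =>
      (q.2, q.1.1 - q.1.2.2, q.1.2.1 - q.1.2.2) := by fun_prop
  exact measurable_measure_prodMk_left (h D.measurableSet_segment_inter_shape).compl

lemma measurable_missProb_comp {α : Type*} [MeasurableSpace α] {y z p : α → Plane}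
    (hy : Measurable y) (hz : Measurable z) (hp : Measurable p) :
    Measurable fun r => D.missProb F (y r) (z r) (p r) := by
  simpa only [Function.comp_def] using (D.measurable_missProb F).comp (hy.prodMk (hz.prodMk hp))

/-- Tonelli for the set of pairs (centre, mark) whose object meets the segment; its section at a
mark is the segment plus the reflected shape. -/
lemma lintegral_one_sub_missProb (y z : Plane) :
    ∫⁻ p, (1 - D.missProb F y z p) = ∫⁻ a, volume (segment ℝ y z + -D.shape a) ∂F := by
  have h : Measurable fun q : Plane × 𝕄 => (q.2, y - q.1, z - q.1) := by fun_prop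
  have hS := h D.measurableSet_segment_inter_shape
  have h1 := Measure.prod_apply (μ := volume) (ν := F) hS
  rw [Measure.prod_apply_symm hS] at h1
  simp_rw [← setOf_segment_sub_inter_nonempty]
  refine Eq.trans (lintegral_congr fun p => ?_) h1.symm
  have h2 : MeasurableSet {a | (segment ℝ (y - p) (z - p) ∩ D.shape a).Nonempty} :=
    measurable_prodMk_left hS
  have h3 := prob_compl_eq_one_sub (μ := F) h2.compl
  rw [compl_compl] at h3
  exact h3.symm

end ObjectModel

/-! ### Integrating out independent marks -/

lemma ProbabilityTheory.IndepFun.lintegral_comp_prod {Ω α β : Type*} [MeasurableSpace Ω]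
    [MeasurableSpace α] [MeasurableSpace β] {P : Measure Ω} [IsFiniteMeasure P] {X : Ω → α}
    {Y : Ω → β} (h : IndepFun X Y P) (hX : Measurable X) (hY : Measurable Y)
    {f : α → β → ℝ≥0∞} (hf : Measurable (Function.uncurry f)) :
    ∫⁻ ω, f (X ω) (Y ω) ∂P = ∫⁻ ω, ∫⁻ ω', f (X ω) (Y ω') ∂P ∂P := by
  have h1 := h.map_prod_eq_prod_map_map hX.aemeasurable hY.aemeasurable
  calc ∫⁻ ω, f (X ω) (Y ω) ∂P
      = ∫⁻ q, Function.uncurry f q ∂(P.map fun ω => (X ω, Y ω)) :=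
        (lintegral_map hf (hX.prodMk hY)).symm
    _ = ∫⁻ x, ∫⁻ y, f x y ∂P.map Y ∂P.map X := by
        rw [h1, lintegral_prod _ hf.aemeasurable]
        rfl
    _ = ∫⁻ ω, ∫⁻ y, f (X ω) y ∂P.map Y ∂P := lintegral_map hf.lintegral_prod_right' hX
    _ = _ := lintegral_congr fun ω => lintegral_map (hf.comp measurable_prodMk_left) hY

lemma ProbabilityTheory.iIndepFun.indepFun_others {Ω ι β : Type*} [MeasurableSpace Ω]
    [MeasurableSpace β] {P : Measure Ω} {M : ι → Ω → β} (h : iIndepFun M P)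
    (hM : ∀ i, Measurable (M i)) (i : ι) :
    IndepFun (M i) (fun ω (j : {j // j ≠ i}) => M j ω) P := by
  have h1 := indep_iSup_of_disjoint (fun j => (hM j).comap_le) h
    (S := {i}) (T := {j | j ≠ i}) (by simp)
  refine indep_of_indep_of_le_left (indep_of_indep_of_le_right h1 ?_) ?_
  · rw [MeasurableSpace.pi, MeasurableSpace.comap_iSup]
    refine iSup_le fun j => ?_
    rw [MeasurableSpace.comap_comp]
    exact le_iSup₂_of_le (j : ι) j.2 le_rfl
  · exact le_iSup₂_of_le i rfl le_rfl

/-- The infinite product of probabilities is the limit of finite ones. Writing it as `expNeg` of a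
sum in `[0, ∞]` covers vanishing factors and products tending to zero. -/
lemma measure_forall_ne_mem {Ω 𝕄 : Type*} [MeasurableSpace Ω] [MeasurableSpace 𝕄]
    {P : Measure Ω} [IsProbabilityMeasure P] {F : Measure 𝕄} [IsProbabilityMeasure F]
    {M : ℕ → Ω → 𝕄} (hM : ∀ i, Measurable (M i)) (hF : ∀ i, HasLaw (M i) F P)
    (h : iIndepFun M P) (i : ℕ) {N : ℕ → Set 𝕄} (hN : ∀ j, MeasurableSet (N j)) :
    P {ω | ∀ j, j ≠ i → M j ω ∈ N j} = expNeg (∑' j, if j = i then 0 else negLog (F (N j))) := by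
  let N' (j : ℕ) : Set 𝕄 := if j = i then Set.univ else N j
  have hN' (j : ℕ) : MeasurableSet (N' j) := by
    dsimp only [N']
    split_ifs
    exacts [MeasurableSet.univ, hN j]
  let S (n : ℕ) : Set Ω := ⋂ j ∈ Finset.range n, M j ⁻¹' N' j
  have hS : {ω | ∀ j, j ≠ i → M j ω ∈ N j} = ⋂ n, S n := by
    ext ω
    simp only [S, Set.mem_iInter, Finset.mem_range, Set.mem_preimage, Set.mem_ofPred_eq, N']
    constructor
    · intro hω n j _
      split_ifs with hj
      exacts [Set.mem_univ _, hω j hj]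
    · intro hω j hj
      simpa [hj] using hω (j + 1) j (Nat.lt_succ_self j)
  have hSanti : Antitone S := fun n m hnm =>
    Set.biInter_subset_biInter_left fun j hj => Finset.range_mono hnm hj
  have hSm (n : ℕ) : MeasurableSet (S n) :=
    Finset.measurableSet_biInter _ fun j _ => hM j (hN' j)
  have h1 : Tendsto (fun n => P (S n)) atTop (𝓝 (P (⋂ n, S n))) :=
    tendsto_measure_iInter_atTop (fun n => (hSm n).nullMeasurableSet) hSanti
      ⟨0, measure_ne_top _ _⟩
  rw [hS]
  refine tendsto_nhds_unique h1 ((tendsto_prod_expNeg _).congr fun n => ?_)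
  rw [h.measure_inter_preimage_eq_mul (Finset.range n) fun j _ => hN' j]
  refine Finset.prod_congr rfl fun j _ => ?_
  dsimp only [N']
  split_ifs with hj
  · simp
  · rw [expNeg_negLog prob_le_one]
    exact ((hF j).measure_eq (hN j)).symm

/-- The mark of object `i` is independent of the whole family of the others, so it can be frozen at
`m` while they are integrated out. -/
lemma lintegral_mul_indicator_forall_ne {Ω 𝕄 : Type*} [MeasurableSpace Ω] [MeasurableSpace 𝕄]
    {P : Measure Ω} [IsProbabilityMeasure P] {F : Measure 𝕄} [IsProbabilityMeasure F]
    {M : ℕ → Ω → 𝕄} (hM : ∀ i, Measurable (M i)) (hF : ∀ i, HasLaw (M i) F P)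
    (h : iIndepFun M P) (i : ℕ) {v : 𝕄 → ℝ≥0∞} (hv : Measurable v) {N : ℕ → Set (𝕄 × 𝕄)}
    (hN : ∀ j, MeasurableSet (N j)) :
    ∫⁻ ω, v (M i ω) * Set.indicator {ω | ∀ j, j ≠ i → (M i ω, M j ω) ∈ N j} 1 ω ∂P =
      ∫⁻ m, v m * expNeg (∑' j, if j = i then 0 else negLog (F {a | (m, a) ∈ N j})) ∂F := by
  let f (m : 𝕄) (w : {j // j ≠ i} → 𝕄) : ℝ≥0∞ :=
    v m * Set.indicator {q : 𝕄 × ({j // j ≠ i} → 𝕄) |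
      ∀ j : {j // j ≠ i}, (q.1, q.2 j) ∈ N j} 1 (m, w)
  have hset : MeasurableSet {q : 𝕄 × ({j // j ≠ i} → 𝕄) |
      ∀ j : {j // j ≠ i}, (q.1, q.2 j) ∈ N j} := by
    rw [show {q : 𝕄 × ({j // j ≠ i} → 𝕄) | ∀ j : {j // j ≠ i}, (q.1, q.2 j) ∈ N j} =
      ⋂ j : {j // j ≠ i}, {q | (q.1, q.2 j) ∈ N j} by ext; simp]
    exact MeasurableSet.iInter fun j => (measurable_fst.prodMk
      ((measurable_pi_apply j).comp measurable_snd)) (hN j)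
  have hf : Measurable (Function.uncurry f) :=
    (hv.comp measurable_fst).mul (measurable_one.indicator hset)
  have hind := (h.indepFun_others hM i).lintegral_comp_prod (hM i)
    (measurable_pi_lambda _ fun j => hM j) hf
  have hleft (ω : Ω) : f (M i ω) (fun j => M j ω) =
      v (M i ω) * Set.indicator {ω | ∀ j, j ≠ i → (M i ω, M j ω) ∈ N j} 1 ω := by
    simp only [f, Subtype.forall]
    rfl
  simp_rw [hleft] at hind
  rw [hind]
  have hright (m : 𝕄) : ∫⁻ ω', f m (fun j => M j ω') ∂P =
      v m * expNeg (∑' j, if j = i then 0 else negLog (F {a | (m, a) ∈ N j})) := by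
    have hNm (j : ℕ) : MeasurableSet {a | (m, a) ∈ N j} := measurable_prodMk_left (hN j)
    rw [← measure_forall_ne_mem hM hF h i hNm]
    have hset' : MeasurableSet {ω | ∀ j, j ≠ i → M j ω ∈ {a | (m, a) ∈ N j}} := by
      rw [show {ω | ∀ j, j ≠ i → M j ω ∈ {a | (m, a) ∈ N j}} =
        ⋂ j, ⋂ (_ : j ≠ i), {ω | M j ω ∈ {a | (m, a) ∈ N j}} by ext; simp]
      exact MeasurableSet.iInter fun j => MeasurableSet.iInter fun _ => hM j (hNm j)
    have hm1 : Measurable fun ω =>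
        Set.indicator {ω | ∀ j, j ≠ i → M j ω ∈ {a | (m, a) ∈ N j}} (1 : Ω → ℝ≥0∞) ω :=
      measurable_one.indicator hset'
    rw [← lintegral_indicator_one hset', ← lintegral_const_mul _ hm1]
    refine lintegral_congr fun ω' => ?_
    simp only [f, Subtype.forall]
    rfl
  have hmeas : Measurable fun m =>
      v m * expNeg (∑' j, if j = i then 0 else negLog (F {a | (m, a) ∈ N j})) := by
    simp_rw [← hright]
    exact (hf.comp (measurable_id.prodMap (measurable_pi_lambda
      (fun ω (j : {j // j ≠ i}) => M j ω) fun j => hM j))).lintegral_prod_right'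
  simp_rw [hright]
  have hmap := lintegral_map (μ := P) hmeas (hM i)
  rw [(hF i).map_eq] at hmap
  exact hmap.symm

/-! ### Coverage sets -/

namespace ObjectModel

variable {𝕄 : Type*} [MeasurableSpace 𝕄] (D : ObjectModel 𝕄)

lemma segment_inter_environmentExcept (y z : Plane) (x : ℕ → Plane) (m : ℕ → 𝕄) (i : ℕ) :
    segment ℝ y z ∩ D.environmentExcept x m i = ∅ ↔
      ∀ j, j ≠ i → ¬ (segment ℝ (y - x j) (z - x j) ∩ D.shape (m j)).Nonempty := by
  rw [Set.eq_empty_iff_forall_notMem]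
  constructor
  · rintro h j hj ⟨s, hs, hsA⟩
    refine h (s + x j) ⟨mem_segment_sub_iff.1 hs, ?_⟩
    simp only [environmentExcept, region, Set.mem_iUnion]
    exact ⟨j, hj, x j, rfl, s, hsA, add_comm _ _⟩
  · rintro h s ⟨hs, hsE⟩
    simp only [environmentExcept, region, Set.mem_iUnion] at hsE
    obtain ⟨j, hj, _, rfl, a, ha, rfl⟩ := hsE
    exact h j hj ⟨a, mem_segment_sub_iff.2 (by simpa [add_comm] using hs), ha⟩

lemma measurableSet_segment_inter_environmentExcept (y : Plane) (x : ℕ → Plane) (m : ℕ → 𝕄)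
    (i : ℕ) : MeasurableSet {z | segment ℝ y z ∩ D.environmentExcept x m i = ∅} := by
  simp_rw [segment_inter_environmentExcept]
  rw [show {z | ∀ j, j ≠ i → ¬ (segment ℝ (y - x j) (z - x j) ∩ D.shape (m j)).Nonempty} =
    ⋂ j, ⋂ (_ : j ≠ i), {z | (segment ℝ (y - x j) (z - x j) ∩ D.shape (m j)).Nonempty}ᶜ by
      ext; simp]
  refine MeasurableSet.iInter fun j => MeasurableSet.iInter fun _ => MeasurableSet.compl ?_
  have h : Measurable fun z : Plane => (m j, y - x j, z - x j) := by fun_prop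
  exact h D.measurableSet_segment_inter_shape

/-- The part of the sensing support outside of the object itself. -/
def outerSupport (m : 𝕄) : Set Plane := ({D.offset m} + D.support m) \ D.shape m

lemma measurableSet_mem_outerSupport :
    MeasurableSet {q : 𝕄 × Plane | q.2 ∈ D.outerSupport q.1} :=
  D.measurableSet_mem_support.diff D.measurableSet_mem_shape

lemma measurableSet_support (m : 𝕄) : MeasurableSet ({D.offset m} + D.support m) :=
  measurable_prodMk_left D.measurableSet_mem_support

lemma measurableSet_outerSupport (m : 𝕄) : MeasurableSet (D.outerSupport m) :=
  measurable_prodMk_left D.measurableSet_mem_outerSupport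

lemma support_of_notMem {m : 𝕄} (hm : m ∉ D.sensors) :
    ({D.offset m} + D.support m : Set Plane) = ∅ := by
  simp [support, hm]

lemma clearSet_eq {x : ℕ → Plane} (m : ℕ → 𝕄) {i : ℕ} (hx : x i = 0) :
    D.clearSet x m i = D.outerSupport (m i) ∩
      {z | segment ℝ (D.offset (m i)) z ∩ D.environmentExcept x m i = ∅} := by
  ext z
  simp [clearSet, outerSupport, region, hx]

lemma coverageSet_eq {x : ℕ → Plane} (m : ℕ → 𝕄) {i : ℕ} (hx : x i = 0) :
    D.coverageSet x m i = (({D.offset (m i)} + D.support (m i)) ∩ D.shape (m i)) ∪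
      (D.outerSupport (m i) ∩
        {z | segment ℝ (D.offset (m i)) z ∩ D.environmentExcept x m i ⊆ {z}}) := by
  ext z
  have h0 : ({0} : Set Plane) + D.shape (m i) = D.shape (m i) := by simp
  simp only [coverageSet, outerSupport, region, hx, zero_add, h0, Set.mem_ofPred_eq,
    Set.mem_union, Set.mem_inter_iff, Set.mem_sdiff]
  tauto

/-- The two pieces are separated by the own shape. As this identity holds for each configuration,
joint measurability is needed only for the clear set, not for the coverage set. -/
lemma volume_coverageSet {x : ℕ → Plane} (m : ℕ → 𝕄) {i : ℕ} (hx : x i = 0) :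
    volume (D.coverageSet x m i) =
      volume (({D.offset (m i)} + D.support (m i)) ∩ D.shape (m i)) +
        volume (D.clearSet x m i) := by
  have hU := D.measurableSet_segment_inter_environmentExcept (D.offset (m i)) x m i
  have hnull := volume_visible_diff_clear _ _ hU
  have hshape : MeasurableSet (D.shape (m i)) := (D.isClosed_shape _).measurableSet
  rw [D.coverageSet_eq m hx, measure_union' _ ((D.measurableSet_support _).inter hshape)]
  · congr 1
    rw [D.clearSet_eq m hx]
    refine le_antisymm ?_ (measure_mono (Set.inter_subset_inter_right _ fun z hz => ?_))
    · calc _ ≤ volume ((D.outerSupport (m i) ∩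
            {z | segment ℝ (D.offset (m i)) z ∩ D.environmentExcept x m i = ∅}) ∪
            ({z | segment ℝ (D.offset (m i)) z ∩ D.environmentExcept x m i ⊆ {z}} \
            {z | segment ℝ (D.offset (m i)) z ∩ D.environmentExcept x m i = ∅})) := by
            refine measure_mono ?_
            rintro z ⟨hz1, hz2⟩
            by_cases hz3 : segment ℝ (D.offset (m i)) z ∩ D.environmentExcept x m i = ∅
            · exact Or.inl ⟨hz1, hz3⟩
            · exact Or.inr ⟨hz2, hz3⟩
        _ ≤ _ := (measure_union_le _ _).trans_eq (by rw [hnull, add_zero])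
    · have hz' : segment ℝ (D.offset (m i)) z ∩ D.environmentExcept x m i = ∅ := hz
      rw [Set.mem_ofPred_eq, hz']
      exact Set.empty_subset _
  · refine Set.disjoint_left.2 fun z hz hz' => hz'.1.2 hz.2

end ObjectModel

/-! ### Palm means -/

namespace ObjectModel

variable {𝕄 : Type*} [MeasurableSpace 𝕄] (D : ObjectModel 𝕄)

lemma mem_clearSet_sub_iff (x : ℕ → Plane) (m : ℕ → 𝕄) (i : ℕ) (z : Plane) :
    z ∈ D.clearSet (fun j => x j - x i) m i ↔ z ∈ D.outerSupport (m i) ∧ ∀ j, j ≠ i →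
      ¬ (segment ℝ (D.offset (m i) - (x j - x i)) (z - (x j - x i)) ∩ D.shape (m j)).Nonempty := by
  rw [D.clearSet_eq m (sub_self _), ← segment_inter_environmentExcept]
  rfl

lemma measurableSet_mem_clearSet (i : ℕ) :
    MeasurableSet {r : ((ℕ → Plane) × (ℕ → 𝕄)) × Plane |
      r.2 ∈ D.clearSet (fun j => r.1.1 j - r.1.1 i) r.1.2 i} := by
  have hx (j : ℕ) : Measurable fun r : ((ℕ → Plane) × (ℕ → 𝕄)) × Plane => r.1.1 j :=
    (measurable_pi_apply j).comp (measurable_fst.comp measurable_fst)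
  have hm (j : ℕ) : Measurable fun r : ((ℕ → Plane) × (ℕ → 𝕄)) × Plane => r.1.2 j :=
    (measurable_pi_apply j).comp (measurable_snd.comp measurable_fst)
  have h1 : MeasurableSet {r : ((ℕ → Plane) × (ℕ → 𝕄)) × Plane |
      r.2 ∈ D.outerSupport (r.1.2 i)} :=
    ((hm i).prodMk measurable_snd) D.measurableSet_mem_outerSupport
  have h2 (j : ℕ) : MeasurableSet {r : ((ℕ → Plane) × (ℕ → 𝕄)) × Plane |
      (segment ℝ (D.offset (r.1.2 i) - (r.1.1 j - r.1.1 i)) (r.2 - (r.1.1 j - r.1.1 i)) ∩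
        D.shape (r.1.2 j)).Nonempty} :=
    ((hm j).prodMk (((D.measurable_offset.comp (hm i)).sub ((hx j).sub (hx i))).prodMk
      (measurable_snd.sub ((hx j).sub (hx i))))) D.measurableSet_segment_inter_shape
  have heq : {r : ((ℕ → Plane) × (ℕ → 𝕄)) × Plane |
      r.2 ∈ D.clearSet (fun j => r.1.1 j - r.1.1 i) r.1.2 i} =
      {r | r.2 ∈ D.outerSupport (r.1.2 i)} ∩ ⋂ j, ⋂ (_ : j ≠ i), {r |
      (segment ℝ (D.offset (r.1.2 i) - (r.1.1 j - r.1.1 i)) (r.2 - (r.1.1 j - r.1.1 i)) ∩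
        D.shape (r.1.2 j)).Nonempty}ᶜ := by
    ext r
    simp only [Set.mem_ofPred_eq, mem_clearSet_sub_iff, Set.mem_inter_iff, Set.mem_iInter,
      Set.mem_compl_iff]
  rw [heq]
  exact h1.inter (MeasurableSet.iInter fun j => MeasurableSet.iInter fun _ => (h2 j).compl)

/-- The probability that no object other than the `i`-th one meets the line of sight from the
offset of the mark `q.1` to `q.2`, for centres `x` seen from `x i` and independent marks. -/
noncomputable def clearProb (F : Measure 𝕄) (x : ℕ → Plane) (i : ℕ) (q : 𝕄 × Plane) : ℝ≥0∞ :=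
  expNeg (∑' j, if j = i then 0 else negLog (D.missProb F (D.offset q.1) q.2 (x j - x i)))

variable (F : Measure 𝕄) [IsProbabilityMeasure F]

lemma measurable_clearProb {α : Type*} [MeasurableSpace α] {x : ℕ → α → Plane}
    (hx : ∀ j, Measurable (x j)) (i : ℕ) :
    Measurable fun r : α × (𝕄 × Plane) => D.clearProb F (fun j => x j r.1) i r.2 := by
  have h (j : ℕ) : Measurable fun r : α × (𝕄 × Plane) =>
      negLog (D.missProb F (D.offset r.2.1) r.2.2 (x j r.1 - x i r.1)) := by
    refine measurable_negLog.comp (D.measurable_missProb_comp F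
      (D.measurable_offset.comp (measurable_fst.comp measurable_snd))
      (measurable_snd.comp measurable_snd) ?_)
    exact ((hx j).comp measurable_fst).sub ((hx i).comp measurable_fst)
  exact measurable_expNeg.comp (measurable_ite_tsum i h)

variable {Ω : Type*} [MeasurableSpace Ω] {P : Measure Ω} [IsProbabilityMeasure P] {F}

/-- For fixed centres, Tonelli moves the location `z` outside; for each `z` the other marks are then
integrated out. -/
lemma lintegral_volume_clearSet {M : ℕ → Ω → 𝕄} (hM : ∀ i, Measurable (M i))
    (hF : ∀ i, HasLaw (M i) F P) (h : iIndepFun M P) (x : ℕ → Plane) (i : ℕ) :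
    ∫⁻ ω, volume (D.clearSet (fun j => x j - x i) (fun j => M j ω) i) ∂P =
      ∫⁻ q, Set.indicator {q : 𝕄 × Plane | q.2 ∈ D.outerSupport q.1} 1 q *
        D.clearProb F x i q ∂(F.prod volume) := by
  have hS : MeasurableSet {r : Ω × Plane |
      r.2 ∈ D.clearSet (fun j => x j - x i) (fun j => M j r.1) i} :=
    ((measurable_const (a := x)).prodMk (measurable_pi_lambda _ fun j =>
      (hM j).comp measurable_fst)).prodMk measurable_snd (D.measurableSet_mem_clearSet i)
  have hv := D.measurableSet_mem_outerSupport
  have hmeas : Measurable fun q : 𝕄 × Plane =>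
      Set.indicator {q : 𝕄 × Plane | q.2 ∈ D.outerSupport q.1} 1 q * D.clearProb F x i q := by
    have h1 := (D.measurable_clearProb F (α := Unit) (x := fun j _ => x j)
      (fun _ => measurable_const) i).comp ((measurable_const (a := ())).prodMk measurable_id)
    exact (measurable_one.indicator hv).mul (by simpa only [Function.comp_def, id_eq] using h1)
  rw [lintegral_prod_symm _ hmeas.aemeasurable]
  have h1 := Measure.prod_apply (μ := P) (ν := volume) hS
  rw [Measure.prod_apply_symm hS] at h1
  refine h1.symm.trans (lintegral_congr fun z => ?_)
  have hN (j : ℕ) : MeasurableSet {q : 𝕄 × 𝕄 | ¬ (segment ℝ (D.offset q.1 - (x j - x i))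
      (z - (x j - x i)) ∩ D.shape q.2).Nonempty} :=
    ((measurable_snd.prodMk (((D.measurable_offset.comp measurable_fst).sub_const _).prodMk
      measurable_const)) D.measurableSet_segment_inter_shape).compl
  have hvz : Measurable fun m => Set.indicator {q : 𝕄 × Plane | q.2 ∈ D.outerSupport q.1}
      (1 : 𝕄 × Plane → ℝ≥0∞) (m, z) :=
    (measurable_one.indicator hv).comp measurable_prodMk_right
  have hmarks := lintegral_mul_indicator_forall_ne hM hF h i hvz hN
  have hprob (m : 𝕄) : D.clearProb F x i (m, z) = expNeg (∑' j, if j = i then 0 else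
      negLog (F {a | (m, a) ∈ {q : 𝕄 × 𝕄 | ¬ (segment ℝ (D.offset q.1 - (x j - x i))
        (z - (x j - x i)) ∩ D.shape q.2).Nonempty}})) := by
    simp only [clearProb, missProb, Set.mem_ofPred_eq]
  simp_rw [hprob]
  rw [← hmarks]
  rw [← lintegral_indicator_one (measurable_prodMk_right hS)]
  refine lintegral_congr fun ω => ?_
  have hiff : (ω, z) ∈ {r : Ω × Plane |
      r.2 ∈ D.clearSet (fun j => x j - x i) (fun j => M j r.1) i} ↔ _ :=
    D.mem_clearSet_sub_iff x (fun j => M j ω) i z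
  by_cases h1 : z ∈ D.outerSupport (M i ω)
  · rw [Set.indicator_of_mem (s := {q : 𝕄 × Plane | q.2 ∈ D.outerSupport q.1}) h1, Pi.one_apply,
      one_mul]
    by_cases h2 : ω ∈ {ω | ∀ j, j ≠ i → (M i ω, M j ω) ∈ {q : 𝕄 × 𝕄 |
        ¬ (segment ℝ (D.offset q.1 - (x j - x i)) (z - (x j - x i)) ∩ D.shape q.2).Nonempty}}
    · rw [Set.indicator_of_mem h2, Set.indicator_of_mem]
      exact hiff.2 ⟨h1, h2⟩
    · rw [Set.indicator_of_notMem h2, Set.indicator_of_notMem]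
      exact fun h3 => h2 (hiff.1 h3).2
  · rw [Set.indicator_of_notMem (s := {q : 𝕄 × Plane | q.2 ∈ D.outerSupport q.1}) h1, zero_mul,
      Set.indicator_of_notMem]
    exact fun h3 => h1 (hiff.1 h3).1

end ObjectModel

/-! ### Mean sums over the marked Poisson process -/

namespace IsMarkedPoissonProcess

variable {Ω 𝕄 : Type*} [MeasurableSpace Ω] [MeasurableSpace 𝕄] {P : Measure Ω}
  {F : Measure 𝕄} {X : ℕ → Ω → Plane}
  {M : ℕ → Ω → 𝕄} {lam : ℝ≥0} {B : Set Plane}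

lemma lintegral_tsum_mark (hXM : IsMarkedPoissonProcess P X M lam F)
    (hB : MeasurableSet B) {v : 𝕄 → ℝ≥0∞} (hv : Measurable v) :
    ∫⁻ ω, ∑' i, B.indicator 1 (X i ω) * v (M i ω) ∂P = lam * volume B * ∫⁻ m, v m ∂F := by
  have hBi := hXM.points.measurable_indicator hB
  have hvi (i : ℕ) : Measurable fun ω => v (M i ω) := hv.comp (hXM.measurable_mark i)
  have hBv (i : ℕ) : Measurable fun ω => B.indicator 1 (X i ω) * v (M i ω) := (hBi i).mul (hvi i)
  rw [lintegral_tsum fun i => (hBv i).aemeasurable]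
  have h1 (i : ℕ) : ∫⁻ ω, B.indicator 1 (X i ω) * v (M i ω) ∂P =
      (∫⁻ ω, B.indicator 1 (X i ω) ∂P) * ∫⁻ m, v m ∂F := by
    rw [← (hXM.hasLaw_mark i).lintegral_comp hv.aemeasurable]
    refine lintegral_mul_eq_lintegral_mul_lintegral_of_indepFun'' (hBi i).aemeasurable
      (hvi i).aemeasurable ?_
    exact hXM.indepFun_points_marks.comp
      ((measurable_one.indicator hB).comp (measurable_pi_apply i))
      (hv.comp (measurable_pi_apply i))
  simp_rw [h1]
  rw [ENNReal.tsum_mul_right, ← lintegral_tsum fun i => (hBi i).aemeasurable]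
  congr 1
  exact hXM.points.lintegral_pointCount hB

variable [IsProbabilityMeasure P] [IsProbabilityMeasure F] (D : ObjectModel 𝕄)

/-- Marks are integrated first, given the points. Tonelli then puts the pair `q` (own mark,
location) outside, so that the Mecke formula is applied with a function `h` that depends only on the
fixed `q`. -/
lemma lintegral_tsum_volume_clearSet (hXM : IsMarkedPoissonProcess P X M lam F)
    (hB : MeasurableSet B) (hB' : volume B ≠ ∞) :
    ∫⁻ ω, ∑' i, B.indicator 1 (X i ω) *
        volume (D.clearSet (fun j => X j ω - X i ω) (fun j => M j ω) i) ∂P =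
      lam * volume B * ∫⁻ m, (∫⁻ z in D.outerSupport m, expNeg (lam *
        ∫⁻ a, volume (segment ℝ (D.offset m) z + -D.shape a) ∂F)) ∂F := by
  have hBi := hXM.points.measurable_indicator hB
  have hXmeas : Measurable fun ω i => X i ω := measurable_pi_lambda _ hXM.points.measurable
  have hMmeas : Measurable fun ω i => M i ω := measurable_pi_lambda _ hXM.measurable_mark
  have hv := D.measurableSet_mem_outerSupport
  have hf (i : ℕ) : Measurable (Function.uncurry fun (x : ℕ → Plane) (m : ℕ → 𝕄) =>
      B.indicator 1 (x i) * volume (D.clearSet (fun j => x j - x i) m i)) :=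
    ((measurable_one.indicator hB).comp ((measurable_pi_apply i).comp measurable_fst)).mul
      (measurable_measure_prodMk_left (D.measurableSet_mem_clearSet i))
  have hg (i : ℕ) : Measurable fun r : Ω × (𝕄 × Plane) => B.indicator 1 (X i r.1) *
      (Set.indicator {q : 𝕄 × Plane | q.2 ∈ D.outerSupport q.1} 1 r.2 *
        D.clearProb F (fun j => X j r.1) i r.2) :=
    ((hBi i).comp measurable_fst).mul (((measurable_one.indicator hv).comp measurable_snd).mul
      (D.measurable_clearProb F hXM.points.measurable i))
  have hfi (i : ℕ) : Measurable fun ω => B.indicator 1 (X i ω) *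
      volume (D.clearSet (fun j => X j ω - X i ω) (fun j => M j ω) i) :=
    (hf i).comp (hXmeas.prodMk hMmeas)
  have hterm (i : ℕ) : ∫⁻ ω, B.indicator 1 (X i ω) *
      volume (D.clearSet (fun j => X j ω - X i ω) (fun j => M j ω) i) ∂P =
      ∫⁻ q, ∫⁻ ω, B.indicator 1 (X i ω) *
        (Set.indicator {q : 𝕄 × Plane | q.2 ∈ D.outerSupport q.1} 1 q *
          D.clearProb F (fun j => X j ω) i q) ∂P ∂(F.prod volume) := by
    refine (hXM.indepFun_points_marks.lintegral_comp_prod hXmeas hMmeas (hf i)).trans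
      (Eq.trans (lintegral_congr fun ω => ?_) (lintegral_lintegral_swap (hg i).aemeasurable))
    have hfin : B.indicator (1 : Plane → ℝ≥0∞) (X i ω) ≠ ∞ := by
      by_cases hi : X i ω ∈ B <;> simp [hi]
    rw [lintegral_const_mul' _ _ hfin, lintegral_const_mul' _ _ hfin,
      D.lintegral_volume_clearSet hXM.measurable_mark hXM.hasLaw_mark hXM.iIndepFun_mark
        (fun j => X j ω) i]
  rw [lintegral_tsum fun i => (hfi i).aemeasurable]
  simp_rw [hterm]
  have hgi (i : ℕ) : Measurable fun q : 𝕄 × Plane => ∫⁻ ω, B.indicator 1 (X i ω) *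
        (Set.indicator {q : 𝕄 × Plane | q.2 ∈ D.outerSupport q.1} 1 q *
          D.clearProb F (fun j => X j ω) i q) ∂P := (hg i).lintegral_prod_left'
  rw [← lintegral_tsum fun i => (hgi i).aemeasurable]
  have hmecke (q : 𝕄 × Plane) : ∑' i, ∫⁻ ω, B.indicator 1 (X i ω) *
        (Set.indicator {q : 𝕄 × Plane | q.2 ∈ D.outerSupport q.1} 1 q *
          D.clearProb F (fun j => X j ω) i q) ∂P =
      lam * volume B * Set.indicator {q : 𝕄 × Plane | q.2 ∈ D.outerSupport q.1}
        (fun q => expNeg (lam * ∫⁻ a, volume (segment ℝ (D.offset q.1) q.2 + -D.shape a) ∂F))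
          q := by
    have hgq (i : ℕ) : Measurable fun ω => B.indicator 1 (X i ω) *
        (Set.indicator {q : 𝕄 × Plane | q.2 ∈ D.outerSupport q.1} 1 q *
          D.clearProb F (fun j => X j ω) i q) := (hg i).comp measurable_prodMk_right
    rw [← lintegral_tsum fun i => (hgq i).aemeasurable]
    by_cases hq : q ∈ {q : 𝕄 × Plane | q.2 ∈ D.outerSupport q.1}
    · simp_rw [Set.indicator_of_mem hq, Pi.one_apply, one_mul]
      have := hXM.points.lintegral_tsum_expNeg hB hB'
        (D.upperSemicontinuous_negLog_missProb F (D.offset q.1) q.2)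
      simp_rw [expNeg_negLog (D.missProb_le_one F _ _ _), D.lintegral_one_sub_missProb] at this
      exact this
    · simp [Set.indicator_of_notMem hq]
  simp_rw [hmecke]
  have hc : Measurable fun q : 𝕄 × Plane =>
      expNeg (lam * ∫⁻ a, volume (segment ℝ (D.offset q.1) q.2 + -D.shape a) ∂F) := by
    simp_rw [← D.lintegral_one_sub_missProb F]
    refine measurable_expNeg.comp (Measurable.const_mul ?_ _)
    have h : Measurable fun r : (𝕄 × Plane) × Plane =>
        1 - D.missProb F (D.offset r.1.1) r.1.2 r.2 :=
      measurable_const.sub (D.measurable_missProb_comp F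
        (D.measurable_offset.comp (measurable_fst.comp measurable_fst))
        (measurable_snd.comp measurable_fst) measurable_snd)
    exact h.lintegral_prod_right'
  rw [lintegral_const_mul _ (hc.indicator hv), lintegral_prod _ (hc.indicator hv).aemeasurable]
  congr 1
  refine lintegral_congr fun m => ?_
  rw [← lintegral_indicator (D.measurableSet_outerSupport m)]
  rfl

end IsMarkedPoissonProcess

/-! ### From mean sums to Palm means -/

lemma shiftedSum_eq_tsum_indicator {𝕄 : Type*} (T : Set 𝕄) (B : Set Plane)
    (f : (ℕ → Plane) → (ℕ → 𝕄) → ℕ → ℝ≥0∞) (x : ℕ → Plane) (m : ℕ → 𝕄) :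
    shiftedSum T B f x m =
      ∑' i, B.indicator 1 (x i) * (T.indicator 1 (m i) * f (fun j => x j - x i) m i) := by
  refine tsum_congr fun i => ?_
  by_cases h1 : x i ∈ B <;> by_cases h2 : m i ∈ T <;> simp [h1, h2]

lemma lintegral_cond_eq {𝕄 : Type*} [MeasurableSpace 𝕄] (F : Measure 𝕄) {T : Set 𝕄}
    (hT : MeasurableSet T) {v : 𝕄 → ℝ≥0∞} (hv : ∀ m ∉ T, v m = 0) :
    ∫⁻ m, v m ∂F[|T] = (∫⁻ m, v m ∂F) / F T := by
  rw [ProbabilityTheory.cond, lintegral_smul_measure, smul_eq_mul, mul_comm, ← div_eq_mul_inv,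
    ← lintegral_indicator hT]
  congr 2 with m
  by_cases hm : m ∈ T <;> simp [hm, hv]

theorem theorem1 {Ω 𝕄 : Type*} [MeasurableSpace Ω] [MeasurableSpace 𝕄]
    (P : Measure Ω) [IsProbabilityMeasure P] (F : Measure 𝕄) [IsProbabilityMeasure F]
    (D : ObjectModel 𝕄) (hF : F D.sensors ≠ 0)
    (lam : ℝ≥0) (hlam : 0 < lam)
    (X : ℕ → Ω → Plane) (M : ℕ → Ω → 𝕄) (hXM : IsMarkedPoissonProcess P X M lam F)
    (B : Set Plane) (hB : MeasurableSet B) (hB0 : volume B ≠ 0) (hB1 : volume B ≠ ∞) :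
    palmMean P X M D.sensors B (fun x m i => volume (D.coverageSet x m i)) =
        (∫⁻ m, volume (({D.offset m} + D.support m) ∩ D.shape m) ∂F[|D.sensors]) +
          ∫⁻ m, (∫⁻ x in ({D.offset m} + D.support m) \ D.shape m,
            expNeg (lam * ∫⁻ a, volume (segment ℝ (D.offset m) x + -D.shape a) ∂F))
              ∂F[|D.sensors] ∧
      palmMean P X M D.sensors B (fun x m i => volume (D.clearSet x m i)) =
        ∫⁻ m, (∫⁻ x in ({D.offset m} + D.support m) \ D.shape m,
          expNeg (lam * ∫⁻ a, volume (segment ℝ (D.offset m) x + -D.shape a) ∂F))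
            ∂F[|D.sensors] := by
  have hsensors := D.measurableSet_sensors
  have hclear_notMem (x : ℕ → Plane) (m : ℕ → 𝕄) (i : ℕ) (hm : m i ∉ D.sensors) :
      volume (D.clearSet (fun j => x j - x i) m i) = 0 := by
    rw [D.clearSet_eq m (sub_self _), ObjectModel.outerSupport, D.support_of_notMem hm]
    simp
  -- Objects that are not sensors have empty support, so the restriction to sensors is automatic and
  -- the mean sums can run over all objects.
  have hclear (ω : Ω) (i : ℕ) :
      D.sensors.indicator 1 (M i ω) *
          volume (D.clearSet (fun j => X j ω - X i ω) (fun j => M j ω) i) =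
        volume (D.clearSet (fun j => X j ω - X i ω) (fun j => M j ω) i) := by
    by_cases hm : M i ω ∈ D.sensors
    · simp [hm]
    · rw [hclear_notMem (fun j => X j ω) (fun j => M j ω) i hm, mul_zero]
  have hinner_notMem (m : 𝕄) (hm : m ∉ D.sensors) :
      volume (({D.offset m} + D.support m) ∩ D.shape m) = 0 := by
    rw [D.support_of_notMem hm]; simp
  have hcover (ω : Ω) (i : ℕ) :
      D.sensors.indicator 1 (M i ω) *
          volume (D.coverageSet (fun j => X j ω - X i ω) (fun j => M j ω) i) =
        volume (({D.offset (M i ω)} + D.support (M i ω)) ∩ D.shape (M i ω)) +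
          volume (D.clearSet (fun j => X j ω - X i ω) (fun j => M j ω) i) := by
    rw [D.volume_coverageSet _ (sub_self (X i ω))]
    by_cases hm : M i ω ∈ D.sensors
    · simp [hm]
    · rw [hclear_notMem (fun j => X j ω) (fun j => M j ω) i hm, hinner_notMem _ hm, add_zero,
        mul_zero]
  have hdenom : ∫⁻ ω, shiftedSum D.sensors B (fun _ _ _ => 1) (fun i => X i ω)
      (fun i => M i ω) ∂P = lam * volume B * F D.sensors := by
    simp_rw [shiftedSum_eq_tsum_indicator, mul_one]
    rw [hXM.lintegral_tsum_mark hB (measurable_one.indicator hsensors),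
      lintegral_indicator_one hsensors]
  have hratio (t : ℝ≥0∞) : lam * volume B * t / (lam * volume B * F D.sensors) =
      t / F D.sensors :=
    ENNReal.mul_div_mul_left _ _
      (mul_ne_zero (ENNReal.coe_ne_zero.2 hlam.ne') hB0)
      (ENNReal.mul_ne_top ENNReal.coe_ne_top hB1)
  have houter : ∫⁻ m, (∫⁻ x in ({D.offset m} + D.support m) \ D.shape m,
      expNeg (lam * ∫⁻ a, volume (segment ℝ (D.offset m) x + -D.shape a) ∂F)) ∂F[|D.sensors] =
      (∫⁻ m, (∫⁻ x in D.outerSupport m,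
        expNeg (lam * ∫⁻ a, volume (segment ℝ (D.offset m) x + -D.shape a) ∂F)) ∂F) /
          F D.sensors := by
    refine lintegral_cond_eq F hsensors fun m hm => ?_
    rw [D.support_of_notMem hm]
    simp
  have hinner := lintegral_cond_eq F hsensors hinner_notMem
  have hinner_meas : Measurable fun m =>
      volume (({D.offset m} + D.support m) ∩ D.shape m) :=
    measurable_measure_prodMk_left (D.measurableSet_mem_support.inter D.measurableSet_mem_shape)
  constructor
  · rw [palmMean, hdenom, hinner, houter, ← ENNReal.add_div, ← hratio]
    congr 1
    simp_rw [shiftedSum_eq_tsum_indicator, hcover, mul_add]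
    rw [← hXM.lintegral_tsum_mark hB hinner_meas,
      ← hXM.lintegral_tsum_volume_clearSet D hB hB1, ← lintegral_add_left]
    · simp_rw [ENNReal.tsum_add]
    · exact Measurable.tsum fun i => (hXM.points.measurable_indicator hB i).mul
        (hinner_meas.comp (hXM.measurable_mark i))
  · rw [palmMean, hdenom, houter, ← hratio]
    congr 1
    simp_rw [shiftedSum_eq_tsum_indicator, hclear]
    exact hXM.lintegral_tsum_volume_clearSet D hB hB1
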